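/- Let $K$ be a field, $A\neq 0$ a Noetherian (commutative) $K$-algebra and $S=A[x_0,\dots,x_n]$ with the standard grading and $x_0<\dots<x_n$. For a term $x^\alpha\neq 1$ let $\min(x^\alpha)$ be the smallest variable dividing $x^\alpha$, and put $\min(1)=x_n$. The Pommaret cone of $x^\alpha$ is the set of all terms $x^\alpha x^\delta$ such that $x^\delta$ involves only variables $x_i\le\min(x^\alpha)$. Let $J\subseteq S$ be a quasi-stable monomial ideal, i.e. for every term $x^\alpha\in J$ and every $x_j>\min(x^\alpha)$ there is $s\ge 0$ with $x_j^s\,x^\alpha/\min(x^\alpha)\in J$, and let $\mathcal P(J)$ be its Pommaret basis, i.e. the finite set of terms generating $J$ such that the set of terms of $J$ is the disjoint union of the Pommaret cones of the elements of $\mathcal P(J)$. Let $\mathcal N(J)_s$ be the set of terms of degree $s$ not in $J$. Let $G=\{f_\alpha\mid x^\alpha\in\mathcal P(J)\}\subset S$ be a $\mathcal P(J)$-marked basis: each $f_\alpha$ is homogeneous, $x^\alpha$ has coefficient $1$ in $f_\alpha$, no term of $f_\alpha-x^\alpha$ lies in $J$, and for the ideal $I=(G)$ one has, for all $s\geq 0$,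 $$S_s=I_s\oplus\langle\mathcal N(J)_s\rangle^A ,$$ where $\langle\cdot\rangle^A$ denotes the generated $A$-module. Let $\beta_{0,j}^{(k)}$ be the number of terms $x^\alpha\in\mathcal P(J)$ with $\deg x^\alpha=j$ and $\min(x^\alpha)=x_k$, and set $$r_{i,j}=\sum_{k=0}^{n-i}\binom{n-k}{i}\beta_{0,j-i}^{(k)}\qquad(i\ge 0,\ j\in\mathbb Z),$$ so $r_{i,j}=0$ for $i>n$. A graded free resolution $\cdots\to E_1\to E_0\to M\to 0$ of a homogeneous ideal $M\subseteq S$ by free modules of finite rank, $E_i=\bigoplus_j S(-j)^{b_{i,j}}$, is called minimal if each $E_{i+1}$ is mapped into $\mathfrak r E_i$, where $\mathfrak r$ is the ideal of $S$ generated by $x_0,\dots,x_n$ and the Jacobson radical of $A$ (so $\mathfrak r=(x_0,\dots,x_n)$ if $A$ is a field). The $b_{i,j}$ are then the Betti numbers of $M$, $\operatorname{reg}(M)=\sup\{j-i\mid b_{i,j}\ne0\}$, and $\operatorname{pdim}(M)=\sup\{i\mid E_i\neq0\}$ is the length of the resolution (both suprema are $-\infty$ if $M=0$). Then, computing these invariants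 of $I$ and $J$ from arbitrary minimal graded free resolutions of $I$ and of $J$, 1. the Betti numbers $b_{i,j}$ of $I$ satisfy $b_{i,j}\le r_{i,j}$ for all $i\geq 0$ and $j\in\mathbb Z$; 2. $\operatorname{reg}(I)\le\operatorname{reg}(J)$; 3. $\operatorname{pdim}(I)\le\operatorname{pdim}(J)$. -/

import Mathlib

open MvPolynomial

noncomputable section

namespace MarkedBasis

/- Variables are `x_0 < ... < x_n`, indexed by `Fin (n + 1)`.  A term `x^α` is represented by its
exponent vector `α : Fin (n + 1) →₀ ℕ`. -/

/-- Index of the smallest variable occurring in the term `x^α`, with the usual convention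
`min(1) = x_n`, so that every variable is multiplicative for the term `1`. -/
def minVar {n : ℕ} (α : Fin (n + 1) →₀ ℕ) : Fin (n + 1) :=
  if h : α.support.Nonempty then α.support.min' h else Fin.last n

/-- The exponents of the terms that lie in the ideal `J`. -/
def termsOf {n : ℕ} {A : Type*} [CommRing A]
    (J : Ideal (MvPolynomial (Fin (n + 1)) A)) : Set (Fin (n + 1) →₀ ℕ) :=
  {α | monomial α (1 : A) ∈ J}

/-- `J` is generated by a set of terms. -/
def IsMonomialIdeal {n : ℕ} {A : Type*} [CommRing A]
    (J : Ideal (MvPolynomial (Fin (n + 1)) A)) : Prop :=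
  ∃ T : Set (Fin (n + 1) →₀ ℕ), J = Ideal.span ((fun α => monomial α (1 : A)) '' T)

/-- A monomial ideal `J` is quasi-stable if for every term `x^α ∈ J` and every
non-multiplicative variable `x_j` of it (i.e. `x_j > min(x^α)`) some
`x_j^s x^α / min(x^α)`, `s ≥ 0`, lies in `J`. -/
def IsQuasiStable {n : ℕ} {A : Type*} [CommRing A]
    (J : Ideal (MvPolynomial (Fin (n + 1)) A)) : Prop :=
  IsMonomialIdeal J ∧
    ∀ α ∈ termsOf J, ∀ j : Fin (n + 1), minVar α < j →
      ∃ s : ℕ, α - Finsupp.single (minVar α) 1 + Finsupp.single j s ∈ termsOf J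

/-- The Pommaret cone of `x^α`: all `x^α x^δ` where `x^δ` involves only variables
`x_i ≤ min(x^α)`. -/
def pommaretCone {n : ℕ} (α : Fin (n + 1) →₀ ℕ) : Set (Fin (n + 1) →₀ ℕ) :=
  {γ | ∃ δ : Fin (n + 1) →₀ ℕ, (∀ i ∈ δ.support, i ≤ minVar α) ∧ γ = α + δ}

/-- The finite set of terms `P` is a Pommaret basis of the ideal `J`: it generates `J`, and the
terms of `J` are the disjoint union of the Pommaret cones of the elements of `P`. -/
structure IsPommaretBasis {n : ℕ} {A : Type*} [CommRing A]
    (P : Finset (Fin (n + 1) →₀ ℕ)) (J : Ideal (MvPolynomial (Fin (n + 1)) A)) : Prop where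
  span_eq : J = Ideal.span ((fun α => monomial α (1 : A)) '' (P : Set (Fin (n + 1) →₀ ℕ)))
  cones_eq : termsOf J = ⋃ α ∈ P, pommaretCone α
  cones_disjoint : (P : Set (Fin (n + 1) →₀ ℕ)).PairwiseDisjoint pommaretCone

/-- `G = {f_α | α ∈ P}` is a `P`-marked set, where `J` is the ideal generated by `P`: each `f_α`
is homogeneous, has head term `x^α` with coefficient `1`, and all its other terms are not in `J`. -/
structure IsMarkedSet {n : ℕ} {A : Type*} [CommRing A]
    (P : Finset (Fin (n + 1) →₀ ℕ)) (J : Ideal (MvPolynomial (Fin (n + 1)) A))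
    (f : P → MvPolynomial (Fin (n + 1)) A) : Prop where
  homogeneous : ∀ α : P, (f α).IsHomogeneous (Finsupp.degree (α : Fin (n + 1) →₀ ℕ))
  coeff_head : ∀ α : P, coeff (α : Fin (n + 1) →₀ ℕ) (f α) = 1
  tail : ∀ α : P, ∀ γ ∈ (f α - monomial (α : Fin (n + 1) →₀ ℕ) (1 : A)).support, γ ∉ termsOf J

/-- The degree `s` component of an ideal, as an `A`-module. -/
def idealComponent {n : ℕ} {A : Type*} [CommRing A]
    (I : Ideal (MvPolynomial (Fin (n + 1)) A)) (s : ℕ) :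
    Submodule A (MvPolynomial (Fin (n + 1)) A) :=
  Submodule.restrictScalars A I ⊓ homogeneousSubmodule (Fin (n + 1)) A s

/-- The `A`-module generated by the terms of degree `s` that do not lie in `J`. -/
def complementComponent {n : ℕ} {A : Type*} [CommRing A]
    (J : Ideal (MvPolynomial (Fin (n + 1)) A)) (s : ℕ) :
    Submodule A (MvPolynomial (Fin (n + 1)) A) :=
  Submodule.span A ((fun γ => monomial γ (1 : A)) '' {γ | γ ∉ termsOf J ∧ Finsupp.degree γ = s})

/-- The `P`-marked set `G = {f_α | α ∈ P}` is a `P`-marked basis: in every degree `s`, the module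
of all homogeneous polynomials of degree `s` is the direct sum of the degree `s` component of the
ideal generated by `G` and the `A`-module generated by the terms of degree `s` not in `J`. -/
structure IsMarkedBasis {n : ℕ} {A : Type*} [CommRing A]
    (P : Finset (Fin (n + 1) →₀ ℕ)) (J : Ideal (MvPolynomial (Fin (n + 1)) A))
    (f : P → MvPolynomial (Fin (n + 1)) A) : Prop where
  isMarkedSet : IsMarkedSet P J f
  disjoint : ∀ s : ℕ,
    Disjoint (idealComponent (Ideal.span (Set.range f)) s) (complementComponent J s)
  sup_eq : ∀ s : ℕ,
    idealComponent (Ideal.span (Set.range f)) s ⊔ complementComponent J s =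
      homogeneousSubmodule (Fin (n + 1)) A s

/-- `β_{0,j}^{(k)}`: the number of terms in `P` of degree `j` whose smallest variable is `x_k`. -/
def beta {n : ℕ} (P : Finset (Fin (n + 1) →₀ ℕ)) (k : Fin (n + 1)) (j : ℤ) : ℕ :=
  (P.filter fun α => ((Finsupp.degree α : ℕ) : ℤ) = j ∧ minVar α = k).card

/-- `r_{i,j} = ∑_k binom(n-k, i) β_{0,j-i}^{(k)}`.  Summands with `k > n - i` vanish. -/
def resRank {n : ℕ} (P : Finset (Fin (n + 1) →₀ ℕ)) (i : ℕ) (j : ℤ) : ℕ :=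
  ∑ k : Fin (n + 1), (n - (k : ℕ)).choose i * beta P k (j - (i : ℤ))

/-- All terms occurring in `p` have degree `e`, for an integer `e`
(so `p = 0` if `e` is negative). -/
def IsHomogeneousInt {n : ℕ} {A : Type*} [CommRing A]
    (p : MvPolynomial (Fin (n + 1)) A) (e : ℤ) : Prop :=
  ∀ γ ∈ p.support, ((Finsupp.degree γ : ℕ) : ℤ) = e

/-- A minimal graded free resolution `⋯ → E_1 → E_0 → I → 0` of the ideal `I` of
`S = A[x_0, …, x_n]` by free modules of finite rank; it is not required to have finite length.

`E_i = ⊕_a S(-deg i a)` has a basis indexed by `Fin (rank i)` whose `a`-th element has degree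
`deg i a`.  The augmentation `E_0 → I ⊆ S` and the differentials `E_{i+1} → E_i` are graded of
degree zero.

Minimality means that `E_{i+1}` is mapped into `𝔯 E_i`, where `𝔯` is the ideal generated by the
variables and the Jacobson radical of `A`, i.e. consists of the polynomials whose constant
coefficient lies in the Jacobson radical of `A`.  If `A` is a field, `𝔯 = (x_0, …, x_n)`;
if `A` is local, `𝔯` is the maximal homogeneous ideal of `S`. -/
structure MinimalResolution {n : ℕ} {A : Type*} [CommRing A]
    (I : Ideal (MvPolynomial (Fin (n + 1)) A)) where
  rank : ℕ → ℕ
  deg : (i : ℕ) → Fin (rank i) → ℤ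
  aug : (Fin (rank 0) → MvPolynomial (Fin (n + 1)) A) →ₗ[MvPolynomial (Fin (n + 1)) A]
    MvPolynomial (Fin (n + 1)) A
  d : (i : ℕ) → (Fin (rank (i + 1)) → MvPolynomial (Fin (n + 1)) A)
    →ₗ[MvPolynomial (Fin (n + 1)) A] (Fin (rank i) → MvPolynomial (Fin (n + 1)) A)
  aug_graded : ∀ a, IsHomogeneousInt (aug (Pi.single a 1)) (deg 0 a)
  d_graded : ∀ i a b, IsHomogeneousInt (d i (Pi.single a 1) b) (deg (i + 1) a - deg i b)
  range_aug : LinearMap.range aug = I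
  exact_zero : LinearMap.range (d 0) = LinearMap.ker aug
  exact_succ : ∀ i, LinearMap.range (d (i + 1)) = LinearMap.ker (d i)
  minimal : ∀ i a b, constantCoeff (d i (Pi.single a 1) b) ∈ Ideal.jacobson (⊥ : Ideal A)

namespace MinimalResolution

/-- The Betti number `b_{i,j}`: `E_i = ⊕_j S(-j)^{b_{i,j}}`. -/
def betti {n : ℕ} {A : Type*} [CommRing A] {I : Ideal (MvPolynomial (Fin (n + 1)) A)}
    (E : MinimalResolution I) (i : ℕ) (j : ℤ) : ℕ :=
  (Finset.univ.filter fun a : Fin (E.rank i) => E.deg i a = j).card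

/-- The Castelnuovo-Mumford regularity: the supremum (the smallest upper bound) of the `j - i` with
`b_{i,j} ≠ 0`.  It is `⊥` (minus infinity) exactly when the resolution is zero. -/
def reg {n : ℕ} {A : Type*} [CommRing A] {I : Ideal (MvPolynomial (Fin (n + 1)) A)}
    (E : MinimalResolution I) : WithBot (WithTop ℤ) :=
  ⨆ (i : ℕ) (j : ℤ) (_ : E.betti i j ≠ 0), (((j - (i : ℤ) : ℤ) : WithTop ℤ) : WithBot (WithTop ℤ))

/-- The projective dimension: the length of the minimal graded free resolution, i.e. the supremum
of the `i` with `E_i ≠ 0`.  It is `⊥` (minus infinity) exactly when the resolution is zero. -/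
def pdim {n : ℕ} {A : Type*} [CommRing A] {I : Ideal (MvPolynomial (Fin (n + 1)) A)}
    (E : MinimalResolution I) : WithBot ℕ∞ :=
  ⨆ (i : ℕ) (_ : E.rank i ≠ 0), ((i : ℕ∞) : WithBot ℕ∞)

end MinimalResolution

end MarkedBasis

end

/-! Everything is read off from Koszul homology over a residue field $k=A/\mathfrak m$. The
splitting $S=I\oplus\langle\mathcal N(J)\rangle^A$ makes every map of the augmented resolution split
over $A$, so exactness survives reduction modulo $\mathfrak m$. Minimality survives too, since the
Jacobson radical goes to $0$. Over $k$, dimension shifting identifies $b_{i,j}$ with the dimension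
of the Koszul homology $H_i(x_0,\dots,x_n;I_k)_j$, where $I_k$ is the image of $I$
(`betti_eq_finrank`). The same applies to $J$.

Upper bound (`finrank_idealHomology_le`): the elements $x^\delta f_\alpha e_\sigma$ with $x^\delta$
multiplicative for $x^\alpha$ form a $k$-basis of the Koszul complex of $I_k$. Match such cells by
moving the largest movable variable between $x^\delta$ and $e_\sigma$. A multiplicative variable
turns a cell into a cell. A non-multiplicative one forces a rewriting, which strictly lowers the
multiplier in the colexicographic order (`X_mul_mem_coneSpan`). Hence the boundaries of the upper
cells are independent (`card_upperCells_le`), and the homology is bounded by the number of unmatched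
cells. These have $\delta=0$ and $\sigma\subseteq\{l>\min(x^\alpha)\}$, and at most $r_{i,j}$ of
them exist.

For regularity and projective dimension, $b_{i,j}\ne0$ for $I$ gives $r_{i,j}\neq 0$, hence some
$x^\alpha\in\mathcal P(J)$ of degree $j-i$ with $i\le n-\min(x^\alpha)$. Quasi-stability yields a
term $x^\gamma\notin J$ whose products with all $x_l\ge\min(x^\alpha)$ lie in $J$. The boundary of
$x^\gamma e_{\{m,\dots,n\}}$, $x_m=\min(x^\alpha)$, is then a nonzero class for $J$ in homological
degree $n-m$ (`exists_not_subsingleton`), so $J$ has a Betti number at least as far out in both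
directions. -/

noncomputable section

namespace MarkedBasis

/-! ### Homogeneous components of integer degree -/

section Homogeneous

variable {n : ℕ} {k : Type*} [CommRing k]

/-- The homogeneous component of integer degree `e`. -/
def homComp (e : ℤ) : MvPolynomial (Fin (n + 1)) k →ₗ[k] MvPolynomial (Fin (n + 1)) k :=
  if 0 ≤ e then homogeneousComponent e.toNat else 0

lemma coeff_homComp (e : ℤ) (p : MvPolynomial (Fin (n + 1)) k) (γ : Fin (n + 1) →₀ ℕ) :
    coeff γ (homComp e p) = if ((γ.degree : ℕ) : ℤ) = e then coeff γ p else 0 := by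
  unfold homComp
  split_ifs with h1 h2 h2
  · rw [coeff_homogeneousComponent, if_pos (by omega)]
  · rw [coeff_homogeneousComponent, if_neg (by omega)]
  · omega
  · simp

lemma isHomogeneousInt_iff_coeff {p : MvPolynomial (Fin (n + 1)) k} {e : ℤ} :
    IsHomogeneousInt p e ↔ ∀ γ, ((γ.degree : ℕ) : ℤ) ≠ e → coeff γ p = 0 := by
  simp only [IsHomogeneousInt, mem_support_iff]
  exact forall_congr' fun γ => by tauto

lemma IsHomogeneousInt.homComp_eq {p : MvPolynomial (Fin (n + 1)) k} {e : ℤ}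
    (h : IsHomogeneousInt p e) : homComp e p = p := by
  ext γ
  rw [coeff_homComp]
  split_ifs with h1
  · rfl
  · exact (isHomogeneousInt_iff_coeff.1 h γ h1).symm

lemma isHomogeneousInt_homComp (e : ℤ) (p : MvPolynomial (Fin (n + 1)) k) :
    IsHomogeneousInt (homComp e p) e :=
  isHomogeneousInt_iff_coeff.2 fun γ h => by rw [coeff_homComp, if_neg h]

lemma isHomogeneousInt_zero (e : ℤ) :
    IsHomogeneousInt (0 : MvPolynomial (Fin (n + 1)) k) e := by
  simp [IsHomogeneousInt]

lemma IsHomogeneousInt.add {p q : MvPolynomial (Fin (n + 1)) k} {e : ℤ}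
    (hp : IsHomogeneousInt p e) (hq : IsHomogeneousInt q e) : IsHomogeneousInt (p + q) e := by
  rw [isHomogeneousInt_iff_coeff] at *
  intro γ h
  rw [coeff_add, hp γ h, hq γ h, add_zero]

lemma IsHomogeneousInt.smul {p : MvPolynomial (Fin (n + 1)) k} {e : ℤ} (c : k)
    (hp : IsHomogeneousInt p e) : IsHomogeneousInt (c • p) e := by
  rw [isHomogeneousInt_iff_coeff] at *
  intro γ h
  rw [coeff_smul, hp γ h, smul_zero]

lemma isHomogeneousInt_X (j : Fin (n + 1)) :
    IsHomogeneousInt (X j : MvPolynomial (Fin (n + 1)) k) 1 := by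
  rw [isHomogeneousInt_iff_coeff]
  intro γ h
  rw [coeff_X, if_neg]
  rintro rfl
  simp [Finsupp.degree_single] at h

lemma isHomogeneousInt_of_isHomogeneous {p : MvPolynomial (Fin (n + 1)) k} {d : ℕ}
    (hp : p.IsHomogeneous d) : IsHomogeneousInt p d := by
  rw [isHomogeneousInt_iff_coeff]
  intro γ h
  exact hp.coeff_eq_zero (by exact_mod_cast h)

lemma IsHomogeneousInt.isHomogeneous {p : MvPolynomial (Fin (n + 1)) k} {d : ℕ}
    (hp : IsHomogeneousInt p d) : p.IsHomogeneous d := by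
  intro γ h
  have := hp γ (mem_support_iff.2 h)
  rw [show Finsupp.weight (1 : Fin (n + 1) → ℕ) γ = γ.degree from
    (DFunLike.congr_fun Finsupp.degree_eq_weight_one γ).symm]
  exact_mod_cast this

/-- This is what lets the projections to a bidegree commute with the Koszul differential and with
graded maps. -/
lemma homComp_mul {g : MvPolynomial (Fin (n + 1)) k} {d : ℤ} (hg : IsHomogeneousInt g d) (e : ℤ)
    (p : MvPolynomial (Fin (n + 1)) k) : homComp (e + d) (g * p) = g * homComp e p := by
  ext γ
  rw [coeff_homComp, coeff_mul, coeff_mul]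
  split_ifs with h
  · refine Finset.sum_congr rfl fun x hx => ?_
    rw [Finset.HasAntidiagonal.mem_antidiagonal] at hx
    rw [coeff_homComp]
    split_ifs with h2
    · rfl
    · rw [isHomogeneousInt_iff_coeff.1 hg, zero_mul, zero_mul]
      intro h3
      apply h2
      rw [← hx, map_add] at h
      push_cast at h
      linarith
  · symm
    refine Finset.sum_eq_zero fun x hx => ?_
    rw [Finset.HasAntidiagonal.mem_antidiagonal] at hx
    rw [coeff_homComp]
    split_ifs with h2
    · rw [isHomogeneousInt_iff_coeff.1 hg, zero_mul]
      intro h3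
      apply h
      rw [← hx, map_add]
      push_cast
      linarith
    · rw [mul_zero]

lemma IsHomogeneousInt.mul {p q : MvPolynomial (Fin (n + 1)) k} {d e : ℤ}
    (hp : IsHomogeneousInt p d) (hq : IsHomogeneousInt q e) : IsHomogeneousInt (p * q) (e + d) := by
  have := isHomogeneousInt_homComp (e + d) (p * q)
  rwa [homComp_mul hp, hq.homComp_eq] at this

end Homogeneous

/-! ### The Koszul complex -/

section Koszul

variable {n : ℕ} {k : Type*} [CommRing k]

/-- The sign with which `x_j e_τ` occurs in the Koszul differential of `e_{τ ∪ {j}}`. -/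
def koszulSign (k : Type*) [CommRing k] (j : Fin (n + 1)) (τ : Finset (Fin (n + 1))) :
    MvPolynomial (Fin (n + 1)) k :=
  ∏ l ∈ τ, if l < j then -1 else 1

lemma koszulSign_insert {j l : Fin (n + 1)} {τ : Finset (Fin (n + 1))} (h : l ∉ τ) :
    koszulSign k j (insert l τ) = (if l < j then -1 else 1) * koszulSign k j τ := by
  rw [koszulSign, Finset.prod_insert h, koszulSign]

lemma koszulSign_mul_self (j : Fin (n + 1)) (τ : Finset (Fin (n + 1))) :
    koszulSign k j τ * koszulSign k j τ = 1 := by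
  rw [koszulSign, ← Finset.prod_mul_distrib]
  refine Finset.prod_eq_one fun l _ => ?_
  split_ifs <;> simp

lemma koszulSign_eq_or (j : Fin (n + 1)) (τ : Finset (Fin (n + 1))) :
    koszulSign k j τ = 1 ∨ koszulSign k j τ = -1 := by
  induction τ using Finset.induction_on with
  | empty => left; simp [koszulSign]
  | insert a s ha ih =>
    rw [koszulSign_insert ha]
    split_ifs <;> rcases ih with h | h <;> simp [h]

/-- Exactly one of $l<j$ and $j<l$ holds, so exactly one of the two products picks up an extra $-1$.
This is the sign rule behind $d^2=0$. -/
lemma koszulSign_swap {j l : Fin (n + 1)} {τ : Finset (Fin (n + 1))} (hjl : j ≠ l) (hj : j ∉ τ)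
    (hl : l ∉ τ) :
    koszulSign k j τ * koszulSign k l (insert j τ) =
      -(koszulSign k l τ * koszulSign k j (insert l τ)) := by
  rw [koszulSign_insert hj, koszulSign_insert hl]
  rcases lt_or_gt_of_ne hjl with h | h
  · rw [if_pos h, if_neg h.not_gt]; ring
  · rw [if_pos h, if_neg h.not_gt]; ring

variable {M : Type*} [AddCommGroup M] [Module (MvPolynomial (Fin (n + 1)) k) M]
  {M' : Type*} [AddCommGroup M'] [Module (MvPolynomial (Fin (n + 1)) k) M']

/-- The Koszul differential of the variables on the chains `∑_σ z_σ e_σ` with coefficients in a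
module. -/
def koszul : (Finset (Fin (n + 1)) → M) →ₗ[MvPolynomial (Fin (n + 1)) k]
    (Finset (Fin (n + 1)) → M) where
  toFun z τ := ∑ j ∈ τᶜ, (koszulSign k j τ * X j : MvPolynomial (Fin (n + 1)) k) • z (insert j τ)
  map_add' z w := by
    ext τ
    simp [Finset.sum_add_distrib]
  map_smul' c z := by
    ext τ
    simp only [Pi.smul_apply, Finset.smul_sum, RingHom.id_apply]
    exact Finset.sum_congr rfl fun j _ => smul_comm _ _ _

lemma koszul_apply (z : Finset (Fin (n + 1)) → M) (τ : Finset (Fin (n + 1))) :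
    koszul (k := k) z τ =
      ∑ j ∈ τᶜ, (koszulSign k j τ * X j : MvPolynomial (Fin (n + 1)) k) • z (insert j τ) := rfl

lemma koszul_koszul (z : Finset (Fin (n + 1)) → M) : koszul (k := k) (koszul (k := k) z) = 0 := by
  ext τ
  simp only [koszul_apply, Finset.smul_sum, Pi.zero_apply]
  rw [Finset.sum_sigma']
  refine Finset.sum_involution (fun x _ => ⟨x.2, x.1⟩) ?_ ?_ ?_ ?_
  · rintro ⟨j, l⟩ h
    simp only [Finset.mem_sigma, Finset.mem_compl, Finset.mem_insert, not_or] at h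
    obtain ⟨hj, hlj, hl⟩ := h
    rw [Finset.insert_comm j l, smul_smul, smul_smul, ← add_smul]
    have := koszulSign_swap (k := k) (Ne.symm hlj) hj hl
    rw [show (koszulSign k j τ * X j * (koszulSign k l (insert j τ) * X l) +
        koszulSign k l τ * X l * (koszulSign k j (insert l τ) * X j) :
        MvPolynomial (Fin (n + 1)) k) = 0 by linear_combination (X j * X l) * this, zero_smul]
  · rintro ⟨j, l⟩ h _ heq
    simp only [Finset.mem_sigma, Finset.mem_compl, Finset.mem_insert, not_or] at h
    simp only [Sigma.mk.injEq, heq_eq_eq] at heq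
    exact h.2.1 heq.1
  · rintro ⟨j, l⟩ h
    simp only [Finset.mem_sigma, Finset.mem_compl, Finset.mem_insert, not_or] at h ⊢
    exact ⟨h.2.2, Ne.symm h.2.1, h.1⟩
  · rintro ⟨j, l⟩ _
    rfl

lemma koszul_compLeft (φ : M →ₗ[MvPolynomial (Fin (n + 1)) k] M')
    (z : Finset (Fin (n + 1)) → M) :
    koszul (k := k) (φ.compLeft _ z) = φ.compLeft _ (koszul (k := k) z) := by
  ext τ
  simp only [LinearMap.compLeft_apply, Function.comp_apply, koszul_apply, map_sum, map_smul]

/-- Contraction of the Koszul complex in direction of the variable `x_m`: division of the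
coefficients by `x_m` and multiplication by `e_m`. -/
def koszulHomotopy (m : Fin (n + 1)) (z : Finset (Fin (n + 1)) → MvPolynomial (Fin (n + 1)) k) :
    Finset (Fin (n + 1)) → MvPolynomial (Fin (n + 1)) k :=
  fun σ => if m ∈ σ then
    koszulSign k m (σ.erase m) * (z (σ.erase m)).divMonomial (Finsupp.single m 1) else 0

lemma koszulSign_mul_divMonomial (j : Fin (n + 1)) (τ : Finset (Fin (n + 1)))
    (p : MvPolynomial (Fin (n + 1)) k) (s : Fin (n + 1) →₀ ℕ) :
    (koszulSign k j τ * p).divMonomial s = koszulSign k j τ * p.divMonomial s := by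
  rcases koszulSign_eq_or (k := k) j τ with h | h
  · rw [h, one_mul, one_mul]
  · rw [h]
    ext γ
    simp [coeff_divMonomial]

lemma X_mul_divMonomial_of_ne {j m : Fin (n + 1)} (h : j ≠ m) (p : MvPolynomial (Fin (n + 1)) k) :
    (X j * p).divMonomial (Finsupp.single m 1) = X j * p.divMonomial (Finsupp.single m 1) := by
  ext γ
  rw [coeff_divMonomial, coeff_X_mul', coeff_X_mul', coeff_divMonomial]
  have h1 : j ∈ (Finsupp.single m 1 + γ).support ↔ j ∈ γ.support := by
    simp [Ne.symm h]
  simp only [h1]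
  split_ifs with h2
  · congr 1
    rw [add_tsub_assoc_of_le]
    rw [Finsupp.single_le_iff]
    exact Nat.one_le_iff_ne_zero.2 (Finsupp.mem_support_iff.1 h2)
  · rfl

lemma sum_divMonomial {ι : Type*} (s : Finset ι) (f : ι → MvPolynomial (Fin (n + 1)) k)
    (γ : Fin (n + 1) →₀ ℕ) :
    (∑ i ∈ s, f i).divMonomial γ = ∑ i ∈ s, (f i).divMonomial γ := by
  ext η
  simp [coeff_divMonomial, coeff_sum]

/-- The contraction $h$ in direction $x_m$ satisfies $dh+hd=\mathrm{id}-\varepsilon$, where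
$\varepsilon$ sets $x_m$ and $e_m$ to zero. So one variable can be eliminated from a cycle up to
boundaries. -/
lemma koszul_homotopy_add (m : Fin (n + 1))
    (z : Finset (Fin (n + 1)) → MvPolynomial (Fin (n + 1)) k) (τ : Finset (Fin (n + 1))) :
    koszul (k := k) (koszulHomotopy m z) τ + koszulHomotopy m (koszul (k := k) z) τ +
      (if m ∈ τ then 0 else (z τ).modMonomial (Finsupp.single m 1)) = z τ := by
  by_cases hm : m ∈ τ
  · obtain ⟨ρ, hρ, rfl⟩ : ∃ ρ, m ∉ ρ ∧ τ = insert m ρ :=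
      ⟨τ.erase m, by simp, (Finset.insert_erase hm).symm⟩
    have hc : ρᶜ = insert m (insert m ρ)ᶜ := by
      ext x; simp only [Finset.mem_compl, Finset.mem_insert]
      by_cases hx : x = m <;> simp [hx, hρ]
    rw [if_pos (by simp), add_zero, koszulHomotopy, if_pos (by simp), Finset.erase_insert hρ,
      koszul_apply, koszul_apply, hc, Finset.sum_insert (by simp), add_divMonomial, sum_divMonomial,
      smul_eq_mul, mul_assoc, koszulSign_mul_divMonomial, X_mul_divMonomial, mul_add, ← mul_assoc,
      koszulSign_mul_self, one_mul, add_left_comm, Finset.mul_sum, ← Finset.sum_add_distrib]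
    rw [Finset.sum_eq_zero, add_zero]
    intro j hj
    simp only [Finset.mem_compl, Finset.mem_insert, not_or] at hj
    rw [koszulHomotopy, if_pos (by simp), smul_eq_mul, smul_eq_mul, Finset.insert_comm j m,
      Finset.erase_insert (by simp [hρ, Ne.symm hj.1]), mul_assoc,
      mul_assoc (koszulSign k j ρ), koszulSign_mul_divMonomial,
      X_mul_divMonomial_of_ne hj.1]
    have h1 := koszulSign_swap (k := k) hj.1 hj.2 hρ
    have h2 := koszulSign_mul_self (k := k) j ρ
    have h3 := koszulSign_mul_self (k := k) j (insert m ρ)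
    -- The swap relation is multiplied by the signs of $x_j$ at $\rho$ and at $\rho\cup\{m\}$; their
    -- squares are then replaced by $1$.
    linear_combination (X j * (z (insert j ρ)).divMonomial (Finsupp.single m 1)) *
      (koszulSign k j ρ * koszulSign k j (insert m ρ) * h1 -
        koszulSign k j (insert m ρ) * koszulSign k m (insert j ρ) * h2 -
        koszulSign k j ρ * koszulSign k m ρ * h3)
  · rw [if_neg hm, koszul_apply, Finset.sum_eq_single m]
    · rw [koszulHomotopy, koszulHomotopy, if_pos (by simp), if_neg hm, Finset.erase_insert hm,
        smul_eq_mul, add_zero, mul_mul_mul_comm, koszulSign_mul_self, one_mul,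
        divMonomial_add_modMonomial_single]
    · intro j _ hj
      rw [koszulHomotopy, if_neg (by simp [hm, Ne.symm hj]), smul_zero]
    · simp [hm]

/-- The Koszul complex of the polynomial ring is exact except for the constants in homological
degree zero. -/
theorem exists_koszul_eq (z : Finset (Fin (n + 1)) → MvPolynomial (Fin (n + 1)) k)
    (hz : koszul (k := k) z = 0) (h0 : constantCoeff (z ∅) = 0) : ∃ w, koszul (k := k) w = z := by
  -- Variables are eliminated one at a time: modulo boundaries, $z$ becomes a cycle free of $x_m$
  -- and $e_m$ for all $m\in s$. For the full set only a constant at $e_\emptyset$ could remain, and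
  -- it is zero.
  have key : ∀ s : Finset (Fin (n + 1)),
      ∃ w : Finset (Fin (n + 1)) → MvPolynomial (Fin (n + 1)) k, (∀ m ∈ s, ∀ τ,
      (m ∈ τ → (z - koszul (k := k) w) τ = 0) ∧
      ∀ γ : Fin (n + 1) →₀ ℕ, γ m ≠ 0 → coeff γ ((z - koszul (k := k) w) τ) = 0) ∧
      constantCoeff ((z - koszul (k := k) w) ∅) = 0 := by
    intro s
    induction s using Finset.induction_on with
    | empty => exact ⟨0, by simp, by simpa using h0⟩
    | insert m s hms ih =>
      obtain ⟨w, hw, hw0⟩ := ih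
      set y := z - koszul (k := k) w with hy
      have hyc : koszul (k := k) y = 0 := by rw [hy, map_sub, hz, koszul_koszul, sub_zero]
      have hyτ : ∀ τ, (y - koszul (k := k) (koszulHomotopy m y)) τ =
          if m ∈ τ then 0 else (y τ).modMonomial (Finsupp.single m 1) := by
        intro τ
        have h1 := koszul_homotopy_add m y τ
        have h2 : koszulHomotopy m (koszul (k := k) y) τ = 0 := by
          rw [hyc, koszulHomotopy]; simp
        rw [h2, add_zero] at h1
        rw [Pi.sub_apply, sub_eq_iff_eq_add', h1]
      refine ⟨w + koszulHomotopy m y, ?_, ?_⟩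
      · rw [map_add, ← sub_sub, ← hy]
        intro l hl τ
        rw [hyτ]
        by_cases hlm : l = m
        · subst hlm
          refine ⟨fun h => by rw [if_pos h], fun γ hγ => ?_⟩
          split_ifs
          · simp
          · apply coeff_modMonomial_of_le
            rw [Finsupp.single_le_iff]
            omega
        -- Variables eliminated earlier do not reappear, because reduction modulo $x_m$ only
        -- discards terms.
        · have hls : l ∈ s := by simpa [hlm] using hl
          refine ⟨fun h => ?_, fun γ hγ => ?_⟩
          · rw [(hw l hls τ).1 h]
            split_ifs
            · rfl
            · ext γ
              by_cases hle : Finsupp.single m 1 ≤ γ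
              · rw [coeff_modMonomial_of_le _ hle, coeff_zero]
              · rw [coeff_modMonomial_of_not_le _ hle]
          · split_ifs
            · simp
            · by_cases hle : Finsupp.single m 1 ≤ γ
              · rw [coeff_modMonomial_of_le _ hle]
              · rw [coeff_modMonomial_of_not_le _ hle]
                exact (hw l hls τ).2 γ hγ
      · rw [map_add, ← sub_sub, ← hy, hyτ, if_neg (by simp), constantCoeff_eq,
          coeff_modMonomial_of_not_le _ (by simp)]
        exact hw0
  obtain ⟨w, hw, hw0⟩ := key Finset.univ
  refine ⟨w, (sub_eq_zero.1 ?_).symm⟩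
  funext τ
  by_cases hτ : τ = ∅
  · subst hτ
    ext γ
    by_cases hγ : γ = 0
    · subst hγ
      simpa [constantCoeff_eq] using hw0
    · obtain ⟨m, hm⟩ := Finsupp.ne_iff.1 hγ
      simpa using (hw m (Finset.mem_univ m) ∅).2 γ hm
  · obtain ⟨m, hm⟩ := Finset.nonempty_iff_ne_empty.2 hτ
    exact (hw m (Finset.mem_univ m) τ).1 hm

end Koszul

/-! ### Graded pieces of the Koszul complex of a graded free module -/

section Graded

variable {n : ℕ} {k : Type*} [CommRing k] {ι ι' : Type*}

/-- The chains of homological degree `p` and internal degree `j` in the Koszul complex of the free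
module whose basis elements have the degrees `deg`. -/
def koszulPart (deg : ι → ℤ) (p : ℕ) (j : ℤ) :
    Submodule k (Finset (Fin (n + 1)) → ι → MvPolynomial (Fin (n + 1)) k) where
  carrier := {z | ∀ σ, (∀ a, IsHomogeneousInt (z σ a) (j - p - deg a)) ∧ (σ.card ≠ p → z σ = 0)}
  add_mem' {z w} hz hw σ := ⟨fun a => ((hz σ).1 a).add ((hw σ).1 a), fun h => by
    rw [Pi.add_apply, (hz σ).2 h, (hw σ).2 h, add_zero]⟩
  zero_mem' σ := ⟨fun a => isHomogeneousInt_zero _, fun _ => rfl⟩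
  smul_mem' c z hz σ := ⟨fun a => ((hz σ).1 a).smul c, fun h => by
    rw [Pi.smul_apply, (hz σ).2 h, smul_zero]⟩

/-- Projection to the chains of homological degree `p` and internal degree `j`. -/
def koszulProj (deg : ι → ℤ) (p : ℕ) (j : ℤ)
    (z : Finset (Fin (n + 1)) → ι → MvPolynomial (Fin (n + 1)) k) :
    Finset (Fin (n + 1)) → ι → MvPolynomial (Fin (n + 1)) k :=
  fun σ a => if σ.card = p then homComp (j - p - deg a) (z σ a) else 0

lemma koszulProj_mem (deg : ι → ℤ) (p : ℕ) (j : ℤ)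
    (z : Finset (Fin (n + 1)) → ι → MvPolynomial (Fin (n + 1)) k) :
    koszulProj deg p j z ∈ koszulPart deg p j := by
  intro σ
  refine ⟨fun a => ?_, fun h => ?_⟩
  · rw [koszulProj]
    split_ifs
    · exact isHomogeneousInt_homComp _ _
    · exact isHomogeneousInt_zero _
  · ext1 a
    rw [koszulProj, if_neg h, Pi.zero_apply]

lemma koszulProj_eq {deg : ι → ℤ} {p : ℕ} {j : ℤ}
    {z : Finset (Fin (n + 1)) → ι → MvPolynomial (Fin (n + 1)) k} (hz : z ∈ koszulPart deg p j) :
    koszulProj deg p j z = z := by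
  ext1 σ; ext1 a
  rw [koszulProj]
  split_ifs with h
  · exact ((hz σ).1 a).homComp_eq
  · rw [(hz σ).2 h, Pi.zero_apply]

lemma isHomogeneousInt_koszulSign (j : Fin (n + 1)) (τ : Finset (Fin (n + 1))) :
    IsHomogeneousInt (koszulSign k j τ) 0 := by
  have h1 : IsHomogeneousInt (1 : MvPolynomial (Fin (n + 1)) k) 0 := by
    simpa using isHomogeneousInt_of_isHomogeneous (isHomogeneous_one (Fin (n + 1)) k)
  rcases koszulSign_eq_or (k := k) j τ with h | h
  · rwa [h]
  · rw [h]
    simpa using h1.smul (-1)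

lemma isHomogeneousInt_koszulSign_mul_X (j : Fin (n + 1)) (τ : Finset (Fin (n + 1))) :
    IsHomogeneousInt (koszulSign k j τ * X j) 1 := by
  simpa using (isHomogeneousInt_koszulSign (k := k) j τ).mul (isHomogeneousInt_X j)

/-- The differential lowers the homological degree by one and raises the coefficient degree by one,
so the internal degree is kept. Any solution of $dw=z$ can therefore be projected to the right
bidegree. -/
lemma koszul_koszulProj (deg : ι → ℤ) (p : ℕ) (j : ℤ)
    (z : Finset (Fin (n + 1)) → ι → MvPolynomial (Fin (n + 1)) k) :
    koszul (k := k) (koszulProj deg (p + 1) j z) = koszulProj deg p j (koszul (k := k) z) := by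
  ext1 τ; ext1 a
  simp only [koszul_apply, koszulProj, Finset.sum_apply, Pi.smul_apply, smul_eq_mul]
  split_ifs with h
  · rw [map_sum]
    refine Finset.sum_congr rfl fun l hl => ?_
    rw [Finset.mem_compl] at hl
    rw [if_pos (by rw [Finset.card_insert_of_notMem hl, h]),
      ← homComp_mul (isHomogeneousInt_koszulSign_mul_X l τ)]
    congr 2
    push_cast
    ring
  · refine Finset.sum_eq_zero fun l hl => ?_
    rw [Finset.mem_compl] at hl
    rw [if_neg (by rw [Finset.card_insert_of_notMem hl]; omega), mul_zero]

lemma koszul_mem {deg : ι → ℤ} {p : ℕ} {j : ℤ}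
    {z : Finset (Fin (n + 1)) → ι → MvPolynomial (Fin (n + 1)) k}
    (hz : z ∈ koszulPart deg (p + 1) j) : koszul (k := k) z ∈ koszulPart deg p j := by
  rw [← koszulProj_eq hz, koszul_koszulProj]
  exact koszulProj_mem _ _ _ _

/-- A linear map of free modules is graded of degree zero. -/
def IsGradedMap [DecidableEq ι] (deg : ι → ℤ) (deg' : ι' → ℤ)
    (φ : (ι → MvPolynomial (Fin (n + 1)) k) →ₗ[MvPolynomial (Fin (n + 1)) k]
      (ι' → MvPolynomial (Fin (n + 1)) k)) : Prop :=
  ∀ a b, IsHomogeneousInt (φ (Pi.single a 1) b) (deg a - deg' b)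

lemma linearMap_pi_apply [Fintype ι] [DecidableEq ι]
    (φ : (ι → MvPolynomial (Fin (n + 1)) k) →ₗ[MvPolynomial (Fin (n + 1)) k]
      (ι' → MvPolynomial (Fin (n + 1)) k)) (v : ι → MvPolynomial (Fin (n + 1)) k) (b : ι') :
    φ v b = ∑ a, φ (Pi.single a 1) b * v a := by
  rw [LinearMap.pi_apply_eq_sum_univ φ v, Finset.sum_apply]
  refine Finset.sum_congr rfl fun a _ => ?_
  rw [Pi.smul_apply, smul_eq_mul, mul_comm]
  rw [show (fun j => if a = j then (1 : MvPolynomial (Fin (n + 1)) k) else 0) = Pi.single a 1 by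
    ext1 i; simp [Pi.single_apply, eq_comm]]

lemma IsGradedMap.compLeft_koszulProj [Fintype ι] [DecidableEq ι] {deg : ι → ℤ} {deg' : ι' → ℤ}
    {φ : (ι → MvPolynomial (Fin (n + 1)) k) →ₗ[MvPolynomial (Fin (n + 1)) k]
      (ι' → MvPolynomial (Fin (n + 1)) k)} (h : IsGradedMap deg deg' φ) (p : ℕ) (j : ℤ)
    (z : Finset (Fin (n + 1)) → ι → MvPolynomial (Fin (n + 1)) k) :
    φ.compLeft _ (koszulProj deg p j z) = koszulProj deg' p j (φ.compLeft _ z) := by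
  ext1 σ; ext1 b
  simp only [LinearMap.compLeft_apply, Function.comp_apply]
  rw [linearMap_pi_apply]
  by_cases hσ : σ.card = p
  · simp only [koszulProj, if_pos hσ]
    rw [LinearMap.compLeft_apply, Function.comp_apply, linearMap_pi_apply φ (z σ), map_sum]
    refine Finset.sum_congr rfl fun a _ => ?_
    rw [← homComp_mul (h a b)]
    congr 2
    ring
  · simp [koszulProj, if_neg hσ]

lemma IsGradedMap.compLeft_mem [Fintype ι] [DecidableEq ι] {deg : ι → ℤ} {deg' : ι' → ℤ}
    {φ : (ι → MvPolynomial (Fin (n + 1)) k) →ₗ[MvPolynomial (Fin (n + 1)) k]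
      (ι' → MvPolynomial (Fin (n + 1)) k)} (h : IsGradedMap deg deg' φ) {p : ℕ} {j : ℤ}
    {z : Finset (Fin (n + 1)) → ι → MvPolynomial (Fin (n + 1)) k} (hz : z ∈ koszulPart deg p j) :
    φ.compLeft _ z ∈ koszulPart deg' p j := by
  rw [← koszulProj_eq hz, h.compLeft_koszulProj]
  exact koszulProj_mem _ _ _ _

/-- Exactness of the Koszul complex of a graded free module, degree by degree. -/
lemma exists_koszul_eq_of_mem {deg : ι → ℤ} {p : ℕ} {j : ℤ}
    {z : Finset (Fin (n + 1)) → ι → MvPolynomial (Fin (n + 1)) k} (hz : z ∈ koszulPart deg p j)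
    (hz0 : koszul (k := k) z = 0) (h0 : ∀ a, constantCoeff (z ∅ a) = 0) :
    ∃ w ∈ koszulPart deg (p + 1) j, koszul (k := k) w = z := by
  have : ∀ a, ∃ w, koszul (k := k) w = fun σ => z σ a := by
    intro a
    refine exists_koszul_eq _ ?_ (h0 a)
    ext1 τ
    have := congrFun (congrFun hz0 τ) a
    simpa [koszul_apply] using this
  choose w hw using this
  refine ⟨koszulProj deg (p + 1) j fun σ a => w a σ, koszulProj_mem _ _ _ _, ?_⟩
  rw [koszul_koszulProj]
  have h1 : koszul (k := k) (fun σ a => w a σ) = z := by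
    ext1 τ; ext1 a
    have := congrFun (hw a) τ
    simpa [koszul_apply] using this
  rw [h1, koszulProj_eq hz]

/-- A graded map is surjective onto its range degree by degree. -/
lemma exists_compLeft_eq_of_mem [Fintype ι] [DecidableEq ι] {deg : ι → ℤ} {deg' : ι' → ℤ}
    {φ : (ι → MvPolynomial (Fin (n + 1)) k) →ₗ[MvPolynomial (Fin (n + 1)) k]
      (ι' → MvPolynomial (Fin (n + 1)) k)} (h : IsGradedMap deg deg' φ) {p : ℕ} {j : ℤ}
    {z : Finset (Fin (n + 1)) → ι' → MvPolynomial (Fin (n + 1)) k}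
    (hz : z ∈ koszulPart deg' p j) (hr : ∀ σ, z σ ∈ LinearMap.range φ) :
    ∃ w ∈ koszulPart deg p j, φ.compLeft _ w = z := by
  choose w hw using hr
  refine ⟨koszulProj deg p j w, koszulProj_mem _ _ _ _, ?_⟩
  rw [h.compLeft_koszulProj]
  have h1 : φ.compLeft _ w = z := funext hw
  rw [h1, koszulProj_eq hz]

end Graded

/-! ### Homology of subspaces under an endomorphism, and dimension shifting -/

section HomologyOf

variable {k : Type*} [CommRing k] {V V' W Q Q' : Type*} [AddCommGroup V] [Module k V]
  [AddCommGroup V'] [Module k V'] [AddCommGroup W] [Module k W] [AddCommGroup Q] [Module k Q]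
  [AddCommGroup Q'] [Module k Q']

/-- The homology of `Z₁ → Z₀ → ·` for an endomorphism `d`: the elements of `Z₀` killed by `d`
modulo the images of the elements of `Z₁`. -/
abbrev HomologyOf (d : V →ₗ[k] V) (Z₁ Z₀ : Submodule k V) : Type _ :=
  ↥(Z₀ ⊓ LinearMap.ker d) ⧸ (Z₁.map d).submoduleOf (Z₀ ⊓ LinearMap.ker d)

/-- Allows two homologies to be compared through a common source, without choosing preimages for a
connecting map. -/
lemma nonempty_equiv_of_ker_eq (f : W →ₗ[k] Q) (g : W →ₗ[k] Q') (hf : Function.Surjective f)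
    (hg : Function.Surjective g) (h : ∀ w, f w = 0 ↔ g w = 0) : Nonempty (Q ≃ₗ[k] Q') := by
  have hker : LinearMap.ker f = LinearMap.ker g := by
    ext w
    exact h w
  exact ⟨(f.quotKerEquivOfSurjective hf).symm.trans
    ((Submodule.quotEquivOfEq _ _ hker).trans (g.quotKerEquivOfSurjective hg))⟩

/-- The class map to the homology. -/
def toHomologyOf (d : V →ₗ[k] V) (Z₁ Z₀ : Submodule k V) (f : W →ₗ[k] V)
    (hf : ∀ w, f w ∈ Z₀ ⊓ LinearMap.ker d) : W →ₗ[k] HomologyOf d Z₁ Z₀ :=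
  (Submodule.mkQ _).comp (f.codRestrict _ hf)

lemma toHomologyOf_eq_zero_iff {d : V →ₗ[k] V} {Z₁ Z₀ : Submodule k V} {f : W →ₗ[k] V}
    {hf : ∀ w, f w ∈ Z₀ ⊓ LinearMap.ker d} {w : W} :
    toHomologyOf d Z₁ Z₀ f hf w = 0 ↔ ∃ z ∈ Z₁, d z = f w := by
  rw [toHomologyOf, LinearMap.comp_apply, Submodule.mkQ_apply, Submodule.Quotient.mk_eq_zero]
  rfl

lemma toHomologyOf_surjective {d : V →ₗ[k] V} {Z₁ Z₀ : Submodule k V} {f : W →ₗ[k] V}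
    {hf : ∀ w, f w ∈ Z₀ ⊓ LinearMap.ker d} (h : ∀ z ∈ Z₀, d z = 0 → ∃ w, f w = z) :
    Function.Surjective (toHomologyOf d Z₁ Z₀ f hf) := by
  refine (Submodule.mkQ_surjective _).comp fun z => ?_
  obtain ⟨w, hw⟩ := h z.1 z.2.1 z.2.2
  exact ⟨w, Subtype.ext hw⟩

/-- The connecting isomorphism of $0\to B\to A\to\varphi(A)\to0$ with $B=\ker\varphi|_A$, where the
needed cycles of $A$ are boundaries. -/
lemma homologyOf_shift {d : V →ₗ[k] V} {d' : V' →ₗ[k] V'} {φ : V →ₗ[k] V'}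
    (hφ : ∀ z, φ (d z) = d' (φ z)) (hd : ∀ z, d (d z) = 0) {A₂ A₁ A₀ B₁ B₀ : Submodule k V}
    (hB₁ : ∀ z, z ∈ B₁ ↔ z ∈ A₁ ∧ φ z = 0) (hB₀ : ∀ z, z ∈ B₀ ↔ z ∈ A₀ ∧ φ z = 0)
    (h₂ : ∀ z ∈ A₂, d z ∈ A₁) (h₁ : ∀ z ∈ A₁, d z ∈ A₀)
    (hex₁ : ∀ z ∈ A₁, d z = 0 → ∃ w ∈ A₂, d w = z)
    (hex₀ : ∀ z ∈ A₀, φ z = 0 → d z = 0 → ∃ w ∈ A₁, d w = z) :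
    Nonempty (HomologyOf d B₁ B₀ ≃ₗ[k] HomologyOf d' (A₂.map φ) (A₁.map φ)) := by
  -- An element $w$ of $W$ represents both $dw$, a cycle of $B$, and $\varphi(w)$, a cycle of
  -- $\varphi(A)$; both class maps are onto with the same kernel.
  let W : Submodule k V := A₁ ⊓ LinearMap.ker (φ.comp d)
  have hW : ∀ w : W, φ (d w) = 0 := fun w => w.2.2
  refine nonempty_equiv_of_ker_eq
    (toHomologyOf d B₁ B₀ (d.comp W.subtype) fun w =>
      ⟨(hB₀ _).2 ⟨h₁ _ w.2.1, hW w⟩, hd _⟩)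
    (toHomologyOf d' (A₂.map φ) (A₁.map φ) (φ.comp W.subtype) fun w =>
      ⟨⟨w, w.2.1, rfl⟩, by
        change d' (φ w) = 0
        rw [← hφ, hW]⟩) ?_ ?_ fun w => ?_
  · refine toHomologyOf_surjective fun z hz hdz => ?_
    rw [hB₀] at hz
    obtain ⟨w, hw, rfl⟩ := hex₀ z hz.1 hz.2 hdz
    exact ⟨⟨w, hw, hz.2⟩, rfl⟩
  · refine toHomologyOf_surjective ?_
    rintro _ ⟨z, hz, rfl⟩ hdz
    rw [← hφ] at hdz
    exact ⟨⟨z, hz, hdz⟩, rfl⟩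
  · refine toHomologyOf_eq_zero_iff.trans (Iff.trans ?_ toHomologyOf_eq_zero_iff.symm)
    constructor
    · rintro ⟨b, hb, hbw⟩
      rw [hB₁] at hb
      obtain ⟨a, ha, haw⟩ := hex₁ (w - b) (A₁.sub_mem w.2.1 hb.1) (by
        rw [map_sub, hbw]; exact sub_self _)
      refine ⟨φ a, ⟨a, ha, rfl⟩, ?_⟩
      rw [← hφ, haw, map_sub, hb.2, sub_zero]
      rfl
    · rintro ⟨_, ⟨a, ha, rfl⟩, haw⟩
      refine ⟨w - d a, (hB₁ _).2 ⟨A₁.sub_mem w.2.1 (h₂ a ha), ?_⟩, ?_⟩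
      · rw [map_sub, hφ, haw]
        exact sub_self _
      · rw [map_sub, hd, sub_zero]
        rfl

end HomologyOf

/-! ### Betti numbers as Koszul homology over a field -/

/-- A minimal graded exact sequence `⋯ → M_2 → M_1 → M_0` of free modules of finite rank over the
polynomial ring over a field. -/
structure GradedExactSeq (n : ℕ) (k : Type*) [Field k] where
  rk : ℕ → ℕ
  deg : (q : ℕ) → Fin (rk q) → ℤ
  φ : (q : ℕ) → (Fin (rk (q + 1)) → MvPolynomial (Fin (n + 1)) k)
    →ₗ[MvPolynomial (Fin (n + 1)) k] (Fin (rk q) → MvPolynomial (Fin (n + 1)) k)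
  graded : ∀ q, IsGradedMap (deg (q + 1)) (deg q) (φ q)
  exact : ∀ q, LinearMap.range (φ (q + 1)) = LinearMap.ker (φ q)
  -- The map with index $0$ is exempt: it will be the augmentation, whose image may contain
  -- constants.
  minimal : ∀ q v b, constantCoeff (φ (q + 1) v b) = 0

/-- The Koszul differential, as a linear map over the coefficients. -/
abbrev koszulₗ (n : ℕ) (k : Type*) [CommRing k] (ι : Type*) :
    (Finset (Fin (n + 1)) → ι → MvPolynomial (Fin (n + 1)) k) →ₗ[k]
      (Finset (Fin (n + 1)) → ι → MvPolynomial (Fin (n + 1)) k) :=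
  (koszul (k := k)).restrictScalars k

namespace GradedExactSeq

variable {n : ℕ} {k : Type*} [Field k] (E : GradedExactSeq n k)

/-- The map of Koszul complexes induced by a map of the sequence. -/
abbrev koszulMap (q : ℕ) :
    (Finset (Fin (n + 1)) → Fin (E.rk (q + 1)) → MvPolynomial (Fin (n + 1)) k) →ₗ[k]
      (Finset (Fin (n + 1)) → Fin (E.rk q) → MvPolynomial (Fin (n + 1)) k) :=
  ((E.φ q).compLeft (Finset (Fin (n + 1)))).restrictScalars k

/-- The part of homological degree `p` and internal degree `j` of the Koszul complex of the
image of the `q`-th map. -/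
def imagePart (q p : ℕ) (j : ℤ) :
    Submodule k (Finset (Fin (n + 1)) → Fin (E.rk q) → MvPolynomial (Fin (n + 1)) k) :=
  (koszulPart (E.deg (q + 1)) p j).map (E.koszulMap q)

/-- The Koszul homology of the image of the `q`-th map. -/
abbrev imageHomology (q p : ℕ) (j : ℤ) : Type _ :=
  HomologyOf (koszulₗ n k (Fin (E.rk q))) (E.imagePart q (p + 1) j) (E.imagePart q p j)

lemma mem_imagePart_succ (q p : ℕ) (j : ℤ)
    (z : Finset (Fin (n + 1)) → Fin (E.rk (q + 1)) → MvPolynomial (Fin (n + 1)) k) :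
    z ∈ E.imagePart (q + 1) p j ↔
      z ∈ koszulPart (E.deg (q + 1)) p j ∧ E.koszulMap q z = 0 := by
  constructor
  · rintro ⟨w, hw, rfl⟩
    refine ⟨(E.graded (q + 1)).compLeft_mem hw, ?_⟩
    ext1 σ
    have : E.φ (q + 1) (w σ) ∈ LinearMap.ker (E.φ q) := by
      rw [← E.exact]
      exact ⟨_, rfl⟩
    exact this
  · rintro ⟨hz, hz0⟩
    refine exists_compLeft_eq_of_mem (E.graded (q + 1)) hz fun σ => ?_
    rw [E.exact]
    exact congrFun hz0 σ

lemma koszulMap_koszul (q : ℕ)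
    (z : Finset (Fin (n + 1)) → Fin (E.rk (q + 1)) → MvPolynomial (Fin (n + 1)) k) :
    E.koszulMap q (koszulₗ n k _ z) = koszulₗ n k _ (E.koszulMap q z) :=
  (koszul_compLeft (E.φ q) z).symm

lemma constantCoeff_eq_zero_of_mem {ι : Type*} {deg : ι → ℤ} {p : ℕ} {j : ℤ}
    {z : Finset (Fin (n + 1)) → ι → MvPolynomial (Fin (n + 1)) k}
    (hz : z ∈ koszulPart deg (p + 1) j) (a : ι) : constantCoeff (z ∅ a) = 0 := by
  rw [(hz ∅).2 (by simp), Pi.zero_apply, map_zero]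

/-- Dimension shift along $0\to M_{q+1}\to F_{q+1}\to M_q\to0$, where $F_{q+1}$ is free and $M_q$ is
the image of the $q$-th map. The Koszul complex of $F_{q+1}$ fails to be exact only at constants in
homological degree $0$, and minimality keeps these out of $M_{q+1}$. -/
lemma nonempty_imageHomology_equiv (q p : ℕ) (j : ℤ) :
    Nonempty (E.imageHomology (q + 1) p j ≃ₗ[k] E.imageHomology q (p + 1) j) := by
  refine homologyOf_shift (φ := E.koszulMap q) (A₀ := koszulPart (E.deg (q + 1)) p j)
    (E.koszulMap_koszul q) (fun z => koszul_koszul z)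
    (E.mem_imagePart_succ q (p + 1) j) (E.mem_imagePart_succ q p j)
    (fun z hz => koszul_mem hz) (fun z hz => koszul_mem hz)
    (fun z hz hz0 => exists_koszul_eq_of_mem hz hz0 fun a => constantCoeff_eq_zero_of_mem hz a)
    (fun z hz hφz hz0 => exists_koszul_eq_of_mem hz hz0 fun a => ?_)
  have : z ∅ ∈ LinearMap.range (E.φ (q + 1)) := by
    rw [E.exact]
    exact congrFun hφz ∅
  obtain ⟨v, hv⟩ := this
  rw [← hv]
  exact E.minimal q v a

lemma koszul_eq_zero_of_mem_zero {ι : Type*} {deg : ι → ℤ} {j : ℤ}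
    {z : Finset (Fin (n + 1)) → ι → MvPolynomial (Fin (n + 1)) k}
    (hz : z ∈ koszulPart deg 0 j) : koszul (k := k) z = 0 := by
  ext1 τ
  rw [koszul_apply]
  refine Finset.sum_eq_zero fun l _ => ?_
  rw [(hz _).2 (by simp), smul_zero]

lemma constantCoeff_koszul {ι : Type*}
    (z : Finset (Fin (n + 1)) → ι → MvPolynomial (Fin (n + 1)) k) (σ : Finset (Fin (n + 1)))
    (a : ι) : constantCoeff (koszul (k := k) z σ a) = 0 := by
  simp [koszul_apply]

/-- In homological degree $0$ the homology is $M/(x_0,\dots,x_n)M$. By minimality the kernel of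
$F_{q+1}\to M_q$ has no constant terms, so this quotient has the basis elements of $F_{q+1}$ as a
$k$-basis. -/
lemma nonempty_imageHomology_zero_equiv (q : ℕ) (j : ℤ) :
    Nonempty (E.imageHomology q 0 j ≃ₗ[k] ({a // E.deg (q + 1) a = j} → k)) := by
  let A := koszulPart (n := n) (k := k) (E.deg (q + 1)) 0 j
  let g : A →ₗ[k] ({a // E.deg (q + 1) a = j} → k) :=
    { toFun := fun z a => constantCoeff (z.1 ∅ a)
      map_add' := fun z w => by ext1 a; simp
      map_smul' := fun c z => by ext1 a; simp }
  refine nonempty_equiv_of_ker_eq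
    (toHomologyOf _ _ _ ((E.koszulMap q).comp A.subtype) fun w => ⟨⟨w, w.2, rfl⟩, ?_⟩) g ?_ ?_
    fun w => ?_
  · change koszulₗ n k _ (E.koszulMap q w) = 0
    rw [← koszulMap_koszul]
    have : koszulₗ n k _ w.1 = 0 := koszul_eq_zero_of_mem_zero w.2
    rw [this, map_zero]
  · refine toHomologyOf_surjective ?_
    rintro _ ⟨z, hz, rfl⟩ _
    exact ⟨⟨z, hz⟩, rfl⟩
  · intro c
    classical
    refine ⟨⟨fun σ a => if h : E.deg (q + 1) a = j then if σ = ∅ then C (c ⟨a, h⟩) else 0 else 0,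
      fun σ => ⟨fun a => ?_, fun h => ?_⟩⟩, ?_⟩
    · dsimp only
      split_ifs with h1 h2
      · rw [h1]
        simpa using isHomogeneousInt_of_isHomogeneous (isHomogeneous_C (Fin (n + 1)) (c ⟨a, h1⟩))
      · exact isHomogeneousInt_zero _
      · exact isHomogeneousInt_zero _
    · ext1 a
      rw [Pi.zero_apply]
      dsimp only
      split_ifs with h1 h2
      · exact absurd (by rw [h2]; rfl) h
      · rfl
      · rfl
    · ext1 ⟨a, ha⟩
      simp [g, ha]
  · have hg : g w = 0 ↔ ∀ a, constantCoeff (w.1 ∅ a) = 0 := by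
      constructor
      · intro h a
        by_cases ha : E.deg (q + 1) a = j
        · exact congrFun h ⟨a, ha⟩
        · rw [constantCoeff_eq]
          refine isHomogeneousInt_iff_coeff.1 ((w.2 ∅).1 a) 0 ?_
          simp only [map_zero, Nat.cast_zero, sub_zero, ne_eq]
          omega
      · intro h
        ext1 a
        exact h a
    refine toHomologyOf_eq_zero_iff.trans (Iff.trans ?_ hg.symm)
    constructor
    · rintro ⟨_, ⟨a, ha, rfl⟩, haw⟩ b
      have h1 : E.koszulMap q (w.1 - koszulₗ n k _ a) = 0 := by
        rw [map_sub, koszulMap_koszul, haw]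
        exact sub_self _
      have h2 : (w.1 - koszulₗ n k _ a) ∅ ∈ LinearMap.range (E.φ (q + 1)) := by
        rw [E.exact]
        exact congrFun h1 ∅
      obtain ⟨v, hv⟩ := h2
      have h3 := E.minimal q v b
      rw [hv, Pi.sub_apply, Pi.sub_apply, map_sub, LinearMap.restrictScalars_apply,
        constantCoeff_koszul, sub_zero] at h3
      exact h3
    · intro h
      obtain ⟨a, ha, haw⟩ := exists_koszul_eq_of_mem w.2 (koszul_eq_zero_of_mem_zero w.2) h
      refine ⟨E.koszulMap q a, ⟨a, ha, rfl⟩, ?_⟩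
      rw [← koszulMap_koszul]
      exact congrArg (E.koszulMap q) haw

/-- The Betti numbers of a minimal graded free resolution are the dimensions of the Koszul
homology of the resolved module. -/
theorem finrank_imageHomology (p q : ℕ) (j : ℤ) :
    Module.finrank k (E.imageHomology q p j) =
      (Finset.univ.filter fun a => E.deg (q + p + 1) a = j).card := by
  -- Each unit of homological degree is traded for one step along the sequence, so $q$ has to vary.
  induction p generalizing q with
  | zero =>
    obtain ⟨e⟩ := E.nonempty_imageHomology_zero_equiv q j
    rw [e.finrank_eq, Module.finrank_fintype_fun_eq_card, Fintype.card_subtype]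
  | succ p ih =>
    obtain ⟨e⟩ := E.nonempty_imageHomology_equiv q p j
    have := ih (q + 1)
    rw [← e.finrank_eq, this, show q + 1 + p + 1 = q + (p + 1) + 1 by ring]

lemma finite_imageHomology (p q : ℕ) (j : ℤ) : Module.Finite k (E.imageHomology q p j) := by
  induction p generalizing q with
  | zero =>
    obtain ⟨e⟩ := E.nonempty_imageHomology_zero_equiv q j
    exact Module.Finite.equiv e.symm
  | succ p ih =>
    obtain ⟨e⟩ := E.nonempty_imageHomology_equiv q p j
    have := ih (q + 1)
    exact Module.Finite.equiv e

end GradedExactSeq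

/-! ### Pommaret cones and reduction modulo a marked basis -/

section Cones

variable {n : ℕ}

lemma apply_eq_zero_of_lt_minVar {α : Fin (n + 1) →₀ ℕ} {i : Fin (n + 1)} (h : i < minVar α) :
    α i = 0 := by
  unfold minVar at h
  split_ifs at h with h1
  · by_contra h2
    exact absurd (α.support.min'_le i (Finsupp.mem_support_iff.2 h2)) (not_le.2 h)
  · rw [Finset.not_nonempty_iff_eq_empty, Finsupp.support_eq_empty] at h1
    rw [h1, Finsupp.zero_apply]

lemma minVar_mem_support {α : Fin (n + 1) →₀ ℕ} (h : α ≠ 0) : minVar α ∈ α.support := by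
  have h1 : α.support.Nonempty := Finsupp.support_nonempty_iff.2 h
  rw [minVar, dif_pos h1]
  exact Finset.min'_mem _ _

/-- Let $i$ be the largest index where $\delta$ and $\varepsilon$ differ, with
$\delta_i>\varepsilon_i$. Then $i\le\min(x^\beta)$, so $\beta$ vanishes below $i$, while $\eta$ and
$\beta$ agree above $i$. Hence $\eta-\beta\ge0$ involves only multiplicative variables of $x^\beta$.
-/
lemma mem_pommaretCone_of_add_eq {β δ η ε : Fin (n + 1) →₀ ℕ} (h : β + δ = η + ε)
    (hδ : ∀ i ∈ δ.support, i ≤ minVar β) (hlt : ¬ toColex δ < toColex ε) :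
    η ∈ pommaretCone β := by
  have hc : ∀ i, β i + δ i = η i + ε i := fun i => DFunLike.congr_fun h i
  rcases (not_lt.1 hlt).lt_or_eq with h1 | h1
  · rw [Finsupp.Colex.lt_iff] at h1
    obtain ⟨i, hi, hlt⟩ := h1
    change ∀ j, i < j → ε j = δ j at hi
    change ε i < δ i at hlt
    have him : i ≤ minVar β := hδ i (Finsupp.mem_support_iff.2 (by omega))
    refine ⟨η - β, fun j hj => ?_, ?_⟩
    · by_contra hjm
      have h2 := hi j (lt_of_le_of_lt him (not_le.1 hjm))
      have h3 := hc j
      rw [Finsupp.mem_support_iff, Finsupp.tsub_apply] at hj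
      omega
    · ext j
      rw [Finsupp.add_apply, Finsupp.tsub_apply]
      have h3 := hc j
      rcases lt_trichotomy j i with hj | hj | hj
      · rw [apply_eq_zero_of_lt_minVar (lt_of_lt_of_le hj him)]
        omega
      · subst hj
        omega
      · have := hi j hj
        omega
  · have h2 : ε = δ := toColex.injective h1
    subst h2
    exact ⟨0, by simp, by simpa using (add_right_cancel h).symm⟩

variable {A : Type*} [CommRing A] {P : Finset (Fin (n + 1) →₀ ℕ)}
  {J : Ideal (MvPolynomial (Fin (n + 1)) A)}

namespace IsPommaretBasis

lemma mem_termsOf_iff [Nontrivial A] (hP : IsPommaretBasis P J) {γ : Fin (n + 1) →₀ ℕ} :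
    γ ∈ termsOf J ↔ ∃ α ∈ P, α ≤ γ := by
  rw [termsOf, Set.mem_ofPred_eq, hP.span_eq, mem_ideal_span_monomial_image]
  simp

lemma exists_cone (hP : IsPommaretBasis P J) {γ : Fin (n + 1) →₀ ℕ} (h : γ ∈ termsOf J) :
    ∃ α ∈ P, ∃ δ : Fin (n + 1) →₀ ℕ, (∀ i ∈ δ.support, i ≤ minVar α) ∧ γ = α + δ := by
  rw [hP.cones_eq] at h
  simpa [pommaretCone] using h

lemma mem_termsOf_of_mem_cone (hP : IsPommaretBasis P J) {α γ : Fin (n + 1) →₀ ℕ} (hα : α ∈ P)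
    (h : γ ∈ pommaretCone α) : γ ∈ termsOf J := by
  rw [hP.cones_eq]
  exact Set.mem_biUnion hα h

lemma eq_of_mem_cone (hP : IsPommaretBasis P J) {α β γ : Fin (n + 1) →₀ ℕ} (hα : α ∈ P)
    (hβ : β ∈ P) (h1 : γ ∈ pommaretCone α) (h2 : γ ∈ pommaretCone β) : α = β := by
  by_contra h
  exact Set.disjoint_left.1 (hP.cones_disjoint hα hβ h) h1 h2

lemma self_mem_cone (α : Fin (n + 1) →₀ ℕ) : α ∈ pommaretCone α := ⟨0, by simp, by simp⟩

/-- Termination of reduction: a tail term $x^\eta$ times a multiplier $x^\varepsilon$, when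
rewritten in a cone, acquires a strictly smaller multiplier. -/
lemma toColex_lt_of_not_mem (hP : IsPommaretBasis P J) {β δ η ε : Fin (n + 1) →₀ ℕ} (hβ : β ∈ P)
    (h : β + δ = η + ε) (hδ : ∀ i ∈ δ.support, i ≤ minVar β) (hη : η ∉ termsOf J) :
    toColex δ < toColex ε := by
  by_contra hlt
  exact hη (hP.mem_termsOf_of_mem_cone hβ (mem_pommaretCone_of_add_eq h hδ hlt))

/-- The analogue for head terms. Otherwise $x^\alpha$ would lie in the cone of $x^\beta$, so
$\alpha=\beta$ and $\delta=\varepsilon$, contradicting that $x^\varepsilon$ is not multiplicative.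
-/
lemma toColex_lt_of_mem (hP : IsPommaretBasis P J) {β δ α ε : Fin (n + 1) →₀ ℕ} (hβ : β ∈ P)
    (hα : α ∈ P) (h : β + δ = α + ε) (hδ : ∀ i ∈ δ.support, i ≤ minVar β)
    (hε : ¬ ∀ i ∈ ε.support, i ≤ minVar α) : toColex δ < toColex ε := by
  by_contra hlt
  have := hP.eq_of_mem_cone hβ hα (mem_pommaretCone_of_add_eq h hδ hlt) (self_mem_cone α)
  subst this
  rw [add_left_cancel h] at hδ
  exact hε hδ

end IsPommaretBasis

/-- The products `x^δ f_β` of degree `s` with `x^δ` multiplicative for `x^β` and `δ` satisfying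
`Q`, and their `A`-linear combinations. -/
def coneSpan (f : P → MvPolynomial (Fin (n + 1)) A) (s : ℕ) (Q : (Fin (n + 1) →₀ ℕ) → Prop) :
    Submodule A (MvPolynomial (Fin (n + 1)) A) :=
  Submodule.span A {p | ∃ (β : P) (δ : Fin (n + 1) →₀ ℕ), (∀ i ∈ δ.support, i ≤ minVar β.1) ∧
    δ.degree + β.1.degree = s ∧ Q δ ∧ p = monomial δ 1 * f β}

lemma mem_of_forall_monomial_mem {N : Submodule A (MvPolynomial (Fin (n + 1)) A)}
    {p : MvPolynomial (Fin (n + 1)) A} (h : ∀ γ ∈ p.support, monomial γ (1 : A) ∈ N) : p ∈ N := by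
  rw [p.as_sum]
  refine N.sum_mem fun γ hγ => ?_
  have := N.smul_mem (coeff γ p) (h γ hγ)
  rwa [smul_monomial, smul_eq_mul, mul_one] at this

namespace IsMarkedSet

variable {f : P → MvPolynomial (Fin (n + 1)) A}

lemma eq_or_not_mem (hf : IsMarkedSet P J f) {α : P} {η : Fin (n + 1) →₀ ℕ}
    (h : η ∈ (f α).support) : η = α ∨ η ∉ termsOf J := by
  by_cases h1 : η = α
  · exact Or.inl h1
  · refine Or.inr (hf.tail α η ?_)
    rw [mem_support_iff] at h ⊢
    rwa [coeff_sub, coeff_monomial, if_neg (Ne.symm h1), sub_zero]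

lemma degree_eq (hf : IsMarkedSet P J f) {α : P} {η : Fin (n + 1) →₀ ℕ}
    (h : η ∈ (f α).support) : η.degree = α.1.degree := by
  have := hf.homogeneous α (mem_support_iff.1 h)
  rw [← this]
  exact DFunLike.congr_fun Finsupp.degree_eq_weight_one η

lemma mem_support_monomial_mul {δ γ : Fin (n + 1) →₀ ℕ} {p : MvPolynomial (Fin (n + 1)) A}
    (h : γ ∈ (monomial δ (1 : A) * p).support) : ∃ η ∈ p.support, γ = η + δ := by
  rw [mem_support_iff, coeff_monomial_mul'] at h
  split_ifs at h with h1
  · exact ⟨γ - δ, by rw [mem_support_iff]; simpa using h, (tsub_add_cancel_of_le h1).symm⟩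
  · exact absurd rfl h

/-- Reduction of a term modulo a marked set. -/
lemma monomial_mem_coneSpan_sup (hP : IsPommaretBasis P J) (hf : IsMarkedSet P J f)
    {Q : (Fin (n + 1) →₀ ℕ) → Prop} (hQ : ∀ δ δ', toColex δ < toColex δ' → Q δ' → Q δ)
    (δ : Colex (Fin (n + 1) →₀ ℕ)) (β : P) (hδ : ∀ i ∈ (ofColex δ).support, i ≤ minVar β.1)
    (hQδ : Q (ofColex δ)) (s : ℕ) (hs : (ofColex δ).degree + β.1.degree = s) :
    monomial (β.1 + ofColex δ) (1 : A) ∈ coneSpan f s Q ⊔ complementComponent J s := by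
  -- Induction on the multiplier in the colexicographic order, across all heads simultaneously.
  induction δ using WellFoundedLT.induction generalizing β with
  | ind δ ih =>
    have h1 : monomial (β.1 + ofColex δ) (1 : A) = monomial (ofColex δ) 1 * f β -
        monomial (ofColex δ) 1 * (f β - monomial β.1 1) := by
      rw [mul_sub, monomial_mul, one_mul, sub_sub_cancel, add_comm β.1]
    rw [h1]
    refine Submodule.sub_mem _ (Submodule.mem_sup_left
      (Submodule.subset_span ⟨β, ofColex δ, hδ, hs, hQδ, rfl⟩)) (mem_of_forall_monomial_mem ?_)
    intro γ hγ
    obtain ⟨η, hη, rfl⟩ := mem_support_monomial_mul hγ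
    have hηJ := hf.tail β η hη
    have hηβ : η ∈ (f β).support := by
      rw [mem_support_iff] at hη ⊢
      rw [coeff_sub, coeff_monomial] at hη
      split_ifs at hη with h2
      · rw [← h2] at hη
        exact absurd (by rw [hf.coeff_head, sub_self]) hη
      · rwa [sub_zero] at hη
    have hdeg : (η + ofColex δ).degree = s := by
      rw [map_add, hf.degree_eq hηβ, add_comm, hs]
    by_cases hmem : η + ofColex δ ∈ termsOf J
    · obtain ⟨β', hβ', δ', hδ', heq⟩ := hP.exists_cone hmem
      have hlt := hP.toColex_lt_of_not_mem hβ' heq.symm hδ' hηJ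
      have := ih (toColex δ') hlt ⟨β', hβ'⟩ hδ' (hQ _ _ hlt hQδ) (by
        rw [← hdeg, heq, map_add, add_comm]; rfl)
      rw [heq]
      exact this
    · exact Submodule.mem_sup_right (Submodule.subset_span ⟨_, ⟨hmem, hdeg⟩, rfl⟩)

end IsMarkedSet

namespace IsMarkedBasis

variable {f : P → MvPolynomial (Fin (n + 1)) A}

lemma coneSpan_le (hf : IsMarkedSet P J f) (s : ℕ) (Q : (Fin (n + 1) →₀ ℕ) → Prop) :
    coneSpan f s Q ≤ idealComponent (Ideal.span (Set.range f)) s := by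
  rw [coneSpan, Submodule.span_le]
  rintro _ ⟨β, δ, -, hs, -, rfl⟩
  refine ⟨Ideal.mul_mem_left _ _ (Ideal.subset_span ⟨β, rfl⟩), ?_⟩
  rw [← hs]
  exact (isHomogeneous_monomial _ rfl).mul (hf.homogeneous β)

/-- The cone part already lies in $I_s$, so the complement part lies in $I_s\cap\langle\mathcal
N(J)_s\rangle=0$. -/
lemma mem_coneSpan (hf : IsMarkedBasis P J f) {s : ℕ} {Q : (Fin (n + 1) →₀ ℕ) → Prop}
    {p : MvPolynomial (Fin (n + 1)) A} (hp : p ∈ idealComponent (Ideal.span (Set.range f)) s)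
    (h : p ∈ coneSpan f s Q ⊔ complementComponent J s) : p ∈ coneSpan f s Q := by
  obtain ⟨l, hl, c, hc, rfl⟩ := Submodule.mem_sup.1 h
  have hl' := coneSpan_le hf.isMarkedSet s Q hl
  have : c ∈ idealComponent (Ideal.span (Set.range f)) s := by
    have := Submodule.sub_mem _ hp hl'
    rwa [add_sub_cancel_left] at this
  rw [Submodule.disjoint_def.1 (hf.disjoint s) c this hc, add_zero]
  exact hl

lemma idealComponent_le_coneSpan (hP : IsPommaretBasis P J) (hf : IsMarkedBasis P J f) (s : ℕ) :
    idealComponent (Ideal.span (Set.range f)) s ≤ coneSpan f s fun _ => True := by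
  intro p hp
  refine hf.mem_coneSpan hp (mem_of_forall_monomial_mem fun γ hγ => ?_)
  have hdeg : γ.degree = s := by
    have : p.IsHomogeneous s := hp.2
    rw [← this (mem_support_iff.1 hγ)]
    exact DFunLike.congr_fun Finsupp.degree_eq_weight_one γ
  by_cases hmem : γ ∈ termsOf J
  · obtain ⟨β, hβ, δ, hδ, rfl⟩ := hP.exists_cone hmem
    exact hf.isMarkedSet.monomial_mem_coneSpan_sup (Q := fun _ => True) hP (fun _ _ _ h => h)
      (toColex δ) ⟨β, hβ⟩ hδ trivial s (by rw [← hdeg, map_add, add_comm]; rfl)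
  · exact Submodule.mem_sup_right (Submodule.subset_span ⟨_, ⟨hmem, hdeg⟩, rfl⟩)

/-- The product of a cone element `x^δ f_α` with a non-multiplicative variable. -/
lemma X_mul_mem_coneSpan (hP : IsPommaretBasis P J) (hf : IsMarkedBasis P J f) {α : P}
    {δ : Fin (n + 1) →₀ ℕ} {j : Fin (n + 1)} (hj : minVar α.1 < j) :
    X j * (monomial δ 1 * f α) ∈ coneSpan f (δ.degree + α.1.degree + 1)
      fun ε => toColex ε < toColex (δ + Finsupp.single j 1) := by
  have h1 : X j * (monomial δ 1 * f α) = monomial (δ + Finsupp.single j 1) (1 : A) * f α := by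
    rw [← mul_assoc, X, monomial_mul, one_mul, add_comm δ]
  have hd : (δ + Finsupp.single j 1).degree = δ.degree + 1 := by
    rw [map_add, Finsupp.degree_single]
  rw [h1]
  refine hf.mem_coneSpan ⟨Ideal.mul_mem_left _ _ (Ideal.subset_span ⟨α, rfl⟩), ?_⟩
    (mem_of_forall_monomial_mem fun γ hγ => ?_)
  · have := (isHomogeneous_monomial (1 : A) hd).mul (hf.isMarkedSet.homogeneous α)
    rwa [add_right_comm] at this
  · obtain ⟨η, hη, rfl⟩ := IsMarkedSet.mem_support_monomial_mul hγ
    have hdeg : (η + (δ + Finsupp.single j 1)).degree = δ.degree + α.1.degree + 1 := by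
      rw [map_add, hf.isMarkedSet.degree_eq hη, hd]
      ring
    by_cases hmem : η + (δ + Finsupp.single j 1) ∈ termsOf J
    · obtain ⟨β, hβ, δ', hδ', heq⟩ := hP.exists_cone hmem
      -- For the head term the multiplier drops because $x_j$ is non-multiplicative, for the other
      -- terms because they lie outside $J$.
      have hlt : toColex δ' < toColex (δ + Finsupp.single j 1) := by
        rcases hf.isMarkedSet.eq_or_not_mem hη with h2 | h2
        · refine hP.toColex_lt_of_mem hβ α.2 (by rw [← heq, h2]) hδ' fun h => ?_
          exact absurd (h j (by simp)) (not_le.2 hj)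
        · exact hP.toColex_lt_of_not_mem hβ heq.symm hδ' h2
      rw [heq]
      exact hf.isMarkedSet.monomial_mem_coneSpan_sup hP (fun _ _ => lt_trans) (toColex δ') ⟨β, hβ⟩
        hδ' hlt (δ.degree + α.1.degree + 1) (by rw [← hdeg, heq, map_add, add_comm]; rfl)
    · exact Submodule.mem_sup_right (Submodule.subset_span ⟨_, ⟨hmem, hdeg⟩, rfl⟩)

end IsMarkedBasis

end Cones

/-! ### Triangular families, dual families and dimension counts over a field -/

/-- Families that are triangular with respect to a family of functionals are independent. -/
lemma linearIndependent_of_triangular {k V ι L : Type*} [Field k] [AddCommGroup V] [Module k V]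
    [LinearOrder L] (v : ι → V) (l : ι → V →ₗ[k] k) (ρ : ι → L) (h1 : ∀ t, l t (v t) ≠ 0)
    (h2 : ∀ t t', l t (v t') ≠ 0 → t' = t ∨ ρ t < ρ t') : LinearIndependent k v := by
  classical
  rw [linearIndependent_iff']
  intro s g hg
  by_contra! h
  obtain ⟨i, hi, hgi⟩ := h
  -- Among the indices with nonzero coefficient, one of greatest rank is chosen: its functional
  -- annihilates all other terms of the relation.
  obtain ⟨t, ht, hmax⟩ := (s.filter fun i => g i ≠ 0).exists_max_image ρ ⟨i, by simp [hi, hgi]⟩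
  rw [Finset.mem_filter] at ht
  have h3 := congrArg (l t) hg
  rw [map_sum, map_zero, Finset.sum_eq_single_of_mem t ht.1] at h3
  · rw [map_smul, smul_eq_mul, mul_eq_zero] at h3
    exact h3.elim ht.2 (h1 t)
  · intro t' ht' hne
    rw [map_smul, smul_eq_mul, mul_eq_zero]
    by_contra! h4
    rcases h2 t t' h4.2 with h5 | h5
    · exact hne h5
    · exact absurd (hmax t' (by simp [ht', h4.1])) (not_le.2 h5)

section LinearAlgebra

variable {k V ι : Type*} [Field k] [AddCommGroup V] [Module k V]

lemma exists_dual_family {v : ι → V} (hv : LinearIndependent k v) :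
    ∃ l : ι → V →ₗ[k] k, (∀ s, l s (v s) = 1) ∧ ∀ s t, s ≠ t → l s (v t) = 0 := by
  have : ∀ s, ∃ g : V →ₗ[k] k, g.comp (Submodule.span k (Set.range v)).subtype =
      (Module.Basis.span hv).coord s := fun s => LinearMap.exists_extend _
  choose l hl using this
  have h : ∀ s t, l s (v t) = (Module.Basis.span hv).coord s (Module.Basis.span hv t) := by
    intro s t
    rw [← hl, LinearMap.comp_apply, Submodule.subtype_apply, Module.Basis.span_apply]
  refine ⟨l, fun s => ?_, fun s t hst => ?_⟩
  · rw [h, Module.Basis.coord_apply, Module.Basis.repr_self, Finsupp.single_eq_same]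
  · rw [h, Module.Basis.coord_apply, Module.Basis.repr_self, Finsupp.single_eq_of_ne hst]

lemma mem_of_apply_span_ne_zero {v : ι → V} {l : V →ₗ[k] k} {s : ι}
    (hl : ∀ t, s ≠ t → l (v t) = 0) {S : Set ι} {x : V} (hx : x ∈ Submodule.span k (v '' S))
    (h : l x ≠ 0) : s ∈ S := by
  by_contra hs
  have : Submodule.span k (v '' S) ≤ LinearMap.ker l := by
    rw [Submodule.span_le]
    rintro _ ⟨t, ht, rfl⟩
    exact hl t fun hst => hs (hst ▸ ht)
  exact h (this hx)

lemma finrank_homologyOf_add {d : V →ₗ[k] V} {Z₁ Z₀ : Submodule k V} [FiniteDimensional k Z₀]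
    (h : ∀ z ∈ Z₁, d z ∈ Z₀) (hd : ∀ z, d (d z) = 0) :
    Module.finrank k (HomologyOf d Z₁ Z₀) + Module.finrank k (Z₁.map d) +
      Module.finrank k (Z₀.map d) = Module.finrank k Z₀ := by
  have hle : Z₁.map d ≤ Z₀ ⊓ LinearMap.ker d := by
    rintro _ ⟨z, hz, rfl⟩
    exact ⟨h z hz, hd z⟩
  have : FiniteDimensional k ↥(Z₀ ⊓ LinearMap.ker d) := Submodule.finiteDimensional_inf_left _ _
  have h1 : Module.finrank k (HomologyOf d Z₁ Z₀) + _ = _ :=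
    Submodule.finrank_quotient_add_finrank ((Z₁.map d).submoduleOf (Z₀ ⊓ LinearMap.ker d))
  rw [(Submodule.submoduleOfEquivOfLe hle).finrank_eq] at h1
  have h2 := LinearMap.finrank_range_add_finrank_ker (d.comp Z₀.subtype)
  have h3 : LinearMap.ker (d.comp Z₀.subtype) = (Z₀ ⊓ LinearMap.ker d).submoduleOf Z₀ := by
    ext z
    change d z = 0 ↔ z.1 ∈ Z₀ ∧ d z = 0
    simp
  rw [LinearMap.range_comp, Submodule.range_subtype, h3,
    (Submodule.submoduleOfEquivOfLe inf_le_left).finrank_eq] at h2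
  omega

end LinearAlgebra

/-! ### Discrete Morse matching on the Koszul complex of an ideal with a marked basis -/

section Morse

variable {n : ℕ} {k : Type*} [Field k]

/-- The coefficient of `e_σ` of an element of the Koszul complex of the polynomial ring. -/
def koszulEntry (k : Type*) [Field k] (σ : Finset (Fin (n + 1))) :
    (Finset (Fin (n + 1)) → Fin 1 → MvPolynomial (Fin (n + 1)) k) →ₗ[k]
      MvPolynomial (Fin (n + 1)) k where
  toFun z := z σ 0
  map_add' _ _ := rfl
  map_smul' _ _ := rfl

/-- The part of homological degree `p` and internal degree `j` of the Koszul complex of an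
ideal. -/
def idealPart (I : Ideal (MvPolynomial (Fin (n + 1)) k)) (p : ℕ) (j : ℤ) :
    Submodule k (Finset (Fin (n + 1)) → Fin 1 → MvPolynomial (Fin (n + 1)) k) :=
  koszulPart (fun _ => 0) p j ⊓
    ⨅ σ, (I.restrictScalars k).comap (koszulEntry k σ)

lemma mem_idealPart {I : Ideal (MvPolynomial (Fin (n + 1)) k)} {p : ℕ} {j : ℤ}
    {z : Finset (Fin (n + 1)) → Fin 1 → MvPolynomial (Fin (n + 1)) k} :
    z ∈ idealPart I p j ↔ z ∈ koszulPart (fun _ => 0) p j ∧ ∀ σ, z σ 0 ∈ I := by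
  simp [idealPart, Submodule.mem_iInf, koszulEntry]

lemma koszul_mem_idealPart {I : Ideal (MvPolynomial (Fin (n + 1)) k)} {p : ℕ} {j : ℤ}
    {z : Finset (Fin (n + 1)) → Fin 1 → MvPolynomial (Fin (n + 1)) k}
    (hz : z ∈ idealPart I (p + 1) j) : koszul (k := k) z ∈ idealPart I p j := by
  rw [mem_idealPart] at *
  refine ⟨koszul_mem hz.1, fun σ => ?_⟩
  rw [koszul_apply, Finset.sum_apply]
  exact I.sum_mem fun l _ => I.mul_mem_left _ (hz.2 _)

/-- The Koszul homology of an ideal. -/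
abbrev IdealHomology (I : Ideal (MvPolynomial (Fin (n + 1)) k)) (p : ℕ) (j : ℤ) : Type _ :=
  HomologyOf (koszulₗ n k (Fin 1)) (idealPart I (p + 1) j) (idealPart I p j)

/-- The element `p e_σ` of the Koszul complex. -/
def koszulSingle (k : Type*) [Field k] (σ : Finset (Fin (n + 1))) :
    MvPolynomial (Fin (n + 1)) k →ₗ[k]
      (Finset (Fin (n + 1)) → Fin 1 → MvPolynomial (Fin (n + 1)) k) :=
  (LinearMap.single k _ σ).comp (LinearMap.pi fun _ => LinearMap.id)

lemma koszulSingle_apply (σ τ : Finset (Fin (n + 1))) (p : MvPolynomial (Fin (n + 1)) k)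
    (a : Fin 1) : koszulSingle k σ p τ a = if τ = σ then p else 0 := by
  rw [koszulSingle, LinearMap.comp_apply, LinearMap.single_apply]
  by_cases h : τ = σ
  · subst h
    simp
  · rw [Pi.single_eq_of_ne h, if_neg h, Pi.zero_apply]

lemma koszul_koszulSingle (σ : Finset (Fin (n + 1))) (p : MvPolynomial (Fin (n + 1)) k) :
    koszul (k := k) (koszulSingle k σ p) =
      ∑ i ∈ σ, koszulSingle k (σ.erase i) (koszulSign k i (σ.erase i) * (X i * p)) := by
  ext1 τ; ext1 a
  rw [koszul_apply, Finset.sum_apply, Finset.sum_apply, Finset.sum_apply]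
  simp only [Pi.smul_apply, koszulSingle_apply, smul_eq_mul, mul_ite, mul_zero]
  rw [← Finset.sum_filter, ← Finset.sum_filter]
  have h : τᶜ.filter (fun i => insert i τ = σ) = σ.filter fun i => τ = σ.erase i := by
    ext i
    simp only [Finset.mem_filter, Finset.mem_compl]
    constructor
    · rintro ⟨h1, rfl⟩
      simp [h1]
    · rintro ⟨h1, rfl⟩
      simp [h1]
  rw [h]
  refine Finset.sum_congr rfl fun i hi => ?_
  rw [(Finset.mem_filter.1 hi).2, mul_assoc]

lemma koszulSign_mul_eq_smul (i : Fin (n + 1)) (τ : Finset (Fin (n + 1))) :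
    ∃ c : k, c ≠ 0 ∧ ∀ p, koszulSign k i τ * p = c • p := by
  rcases koszulSign_eq_or (k := k) i τ with h | h
  · exact ⟨1, one_ne_zero, fun p => by rw [h, one_mul, one_smul]⟩
  · exact ⟨-1, neg_ne_zero.2 one_ne_zero, fun p => by rw [h, neg_mul, one_mul, neg_smul, one_smul]⟩

/-- Indices `(α, δ, σ)` of the elements `x^δ f_α e_σ` of the Koszul complex of an ideal with
marked basis `f`. -/
abbrev Cell (P : Finset (Fin (n + 1) →₀ ℕ)) : Type :=
  P × (Fin (n + 1) →₀ ℕ) × Finset (Fin (n + 1))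

variable {P : Finset (Fin (n + 1) →₀ ℕ)} {J : Ideal (MvPolynomial (Fin (n + 1)) k)}
  {f : P → MvPolynomial (Fin (n + 1)) k}

/-- The indices `(α, δ, σ)` in homological degree `p` and internal degree `j` for which `x^δ` is
multiplicative for `x^α`. -/
def cells (P : Finset (Fin (n + 1) →₀ ℕ)) (p : ℕ) (j : ℤ) : Finset (Cell P) :=
  (Finset.univ ×ˢ (Finsupp.finite_of_degree_le j.toNat).toFinset ×ˢ Finset.univ).filter fun t =>
    (∀ i ∈ t.2.1.support, i ≤ minVar t.1.1) ∧ t.2.2.card = p ∧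
      ((t.2.1.degree + t.1.1.degree + p : ℕ) : ℤ) = j

lemma mem_cells {p : ℕ} {j : ℤ} {t : Cell P} : t ∈ cells P p j ↔
    (∀ i ∈ t.2.1.support, i ≤ minVar t.1.1) ∧ t.2.2.card = p ∧
      ((t.2.1.degree + t.1.1.degree + p : ℕ) : ℤ) = j := by
  rw [cells, Finset.mem_filter, and_iff_right_iff_imp]
  rintro ⟨-, -, h⟩
  simp only [Finset.mem_product, Finset.mem_univ, true_and, and_true, Set.Finite.mem_toFinset]
  change t.2.1.degree ≤ j.toNat
  omega

/-- The element `x^δ f_α e_σ` of the Koszul complex. -/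
def cellVec (f : P → MvPolynomial (Fin (n + 1)) k) (t : Cell P) :
    Finset (Fin (n + 1)) → Fin 1 → MvPolynomial (Fin (n + 1)) k :=
  koszulSingle k t.2.2 (monomial t.2.1 1 * f t.1)

/-- Test with the coefficient of $x^{\alpha+\delta}e_\sigma$. Another cell can contain it only
through a tail term of its $f_{\alpha'}$, and then $\delta<\delta'$; cones are disjoint, so head
terms do not collide. -/
lemma linearIndependent_cellVec (hP : IsPommaretBasis P J) (hf : IsMarkedSet P J f) (p : ℕ)
    (j : ℤ) : LinearIndependent k fun t : cells P p j => cellVec f t := by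
  refine linearIndependent_of_triangular _
    (fun t => (lcoeff k (t.1.1.1 + t.1.2.1)).comp (koszulEntry k t.1.2.2))
    (fun t => toColex t.1.2.1) (fun t => ?_) fun t t' h => ?_
  · simp [cellVec, koszulEntry, koszulSingle_apply, add_comm t.1.1.1, coeff_monomial_mul, hf.coeff_head]
  · simp only [cellVec, LinearMap.comp_apply, koszulEntry, LinearMap.coe_mk, AddHom.coe_mk,
      koszulSingle_apply, lcoeff_apply] at h
    split_ifs at h with h1
    · obtain ⟨η, hη, heq⟩ := IsMarkedSet.mem_support_monomial_mul (mem_support_iff.2 h)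
      have h2 := (mem_cells.1 t.2).1
      rcases hf.eq_or_not_mem hη with h3 | h3
      · left
        rw [h3] at heq
        have h4 := hP.eq_of_mem_cone t.1.1.2 t'.1.1.2 ⟨t.1.2.1, h2, rfl⟩
          ⟨t'.1.2.1, (mem_cells.1 t'.2).1, heq⟩
        rw [h4] at heq
        exact Subtype.ext (Prod.ext (Subtype.ext h4.symm)
          (Prod.ext (add_left_cancel heq).symm h1.symm))
      · exact Or.inr (hP.toColex_lt_of_not_mem t.1.1.2 heq h2 h3)
    · simp at h

lemma koszulSingle_mem_span {σ : Finset (Fin (n + 1))} {p : ℕ} {j : ℤ} (hσ : σ.card = p) {s : ℕ}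
    (hs : ((s + p : ℕ) : ℤ) = j) {Q : (Fin (n + 1) →₀ ℕ) → Prop}
    {g : MvPolynomial (Fin (n + 1)) k} (hg : g ∈ coneSpan f s Q) :
    koszulSingle k σ g ∈ Submodule.span k
      ((fun t : cells P p j => cellVec f t) '' {t | Q t.1.2.1 ∧ t.1.2.2 = σ}) := by
  suffices h : coneSpan f s Q ≤ (Submodule.span k
      ((fun t : cells P p j => cellVec f t) '' {t | Q t.1.2.1 ∧ t.1.2.2 = σ})).comap
        (koszulSingle k σ) from h hg
  rw [coneSpan, Submodule.span_le]
  rintro _ ⟨β, δ, hδ, hdeg, hQ, rfl⟩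
  exact Submodule.subset_span ⟨⟨(β, δ, σ), mem_cells.2 ⟨hδ, hσ, by rw [hdeg]; exact hs⟩⟩,
    ⟨hQ, rfl⟩, rfl⟩

lemma span_cellVec (hP : IsPommaretBasis P J) (hf : IsMarkedBasis P J f) (p : ℕ) (j : ℤ) :
    Submodule.span k (Set.range fun t : cells P p j => cellVec f t) =
      idealPart (Ideal.span (Set.range f)) p j := by
  apply le_antisymm
  · rw [Submodule.span_le]
    rintro _ ⟨⟨⟨β, δ, σ⟩, ht⟩, rfl⟩
    obtain ⟨h1, h2, h3⟩ := mem_cells.1 ht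
    dsimp only at h1 h2 h3
    refine mem_idealPart.2 ⟨fun τ => ⟨fun a => ?_, fun hτ => ?_⟩, fun τ => ?_⟩
    · simp only [cellVec, koszulSingle_apply]
      split_ifs
      · have := isHomogeneousInt_of_isHomogeneous
          ((isHomogeneous_monomial (1 : k) (d := δ) rfl).mul (hf.isMarkedSet.homogeneous β))
        convert this using 1
        push_cast at h3 ⊢
        linarith
      · exact isHomogeneousInt_zero _
    · ext1 a
      simp only [cellVec, koszulSingle_apply]
      rw [if_neg, Pi.zero_apply]
      rintro rfl
      exact hτ h2
    · simp only [cellVec, koszulSingle_apply]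
      split_ifs
      · exact Ideal.mul_mem_left _ _ (Ideal.subset_span ⟨β, rfl⟩)
      · exact Ideal.zero_mem _
  · intro z hz
    rw [mem_idealPart] at hz
    have h1 : z = ∑ σ, koszulSingle k σ (z σ 0) := by
      ext1 τ; ext1 a
      rw [Subsingleton.elim a 0, Finset.sum_apply, Finset.sum_apply]
      simp [koszulSingle_apply]
    rw [h1]
    refine Submodule.sum_mem _ fun σ _ => ?_
    by_cases hσ : σ.card = p
    · by_cases hj : 0 ≤ j - p
      · obtain ⟨s, hs⟩ := Int.eq_ofNat_of_zero_le hj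
        have h2 := (hz.1 σ).1 0
        rw [sub_zero, hs] at h2
        exact Submodule.span_mono (Set.image_subset_range _ _)
          (koszulSingle_mem_span hσ (by push_cast; linarith)
            (hf.idealComponent_le_coneSpan hP s ⟨hz.2 σ, h2.isHomogeneous⟩))
      · have h2 : z σ 0 = 0 := by
          ext γ
          rw [isHomogeneousInt_iff_coeff.1 ((hz.1 σ).1 0) γ (by dsimp only; omega), coeff_zero]
        rw [h2, map_zero]
        exact Submodule.zero_mem _
    · rw [(hz.1 σ).2 hσ, Pi.zero_apply, map_zero]
      exact Submodule.zero_mem _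

namespace Cell

/-- The variables that may be moved between `x^δ` and `e_σ`. -/
def movable (t : Cell P) : Finset (Fin (n + 1)) :=
  t.2.1.support ∪ t.2.2.filter (· ≤ minVar t.1.1)

/-- The largest movable variable. -/
def top (t : Cell P) : Fin (n + 1) := t.movable.sup id

/-- The largest movable variable is exterior. -/
def IsUpper (t : Cell P) : Prop := t.top ∈ t.2.2 ∧ t.top ≤ minVar t.1.1

/-- The largest movable variable is not exterior. -/
def IsLower (t : Cell P) : Prop := t.top ∈ t.2.1.support ∧ t.top ∉ t.2.2

/-- Move the variable `x_i` from the exterior part to the polynomial part. -/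
def down (i : Fin (n + 1)) (t : Cell P) : Cell P :=
  (t.1, t.2.1 + Finsupp.single i 1, t.2.2.erase i)

/-- Move the variable `x_i` from the polynomial part to the exterior part. -/
def up (i : Fin (n + 1)) (t : Cell P) : Cell P :=
  (t.1, t.2.1 - Finsupp.single i 1, insert i t.2.2)

/-- The multidegree of `x^δ e_σ`. -/
def mdeg (t : Cell P) : Fin (n + 1) →₀ ℕ := t.2.1 + ∑ l ∈ t.2.2, Finsupp.single l 1

lemma mem_movable {t : Cell P} {l : Fin (n + 1)} :
    l ∈ t.movable ↔ t.2.1 l ≠ 0 ∨ (l ∈ t.2.2 ∧ l ≤ minVar t.1.1) := by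
  simp [movable]

/-- Invariance of the movable set fixes its largest element, so moving that variable down and up are
inverse operations: this makes the matching well defined. -/
lemma movable_down {t : Cell P} {i : Fin (n + 1)} (hi : i ∈ t.2.2) (him : i ≤ minVar t.1.1) :
    (t.down i).movable = t.movable := by
  ext l
  rw [mem_movable, mem_movable, down, Finsupp.add_apply, Finset.mem_erase]
  by_cases h : l = i
  · subst h
    simp [hi, him]
  · rw [Finsupp.single_eq_of_ne h, add_zero, and_iff_right h]

lemma down_up {t : Cell P} {i : Fin (n + 1)} (hi : i ∈ t.2.1.support) (hi' : i ∉ t.2.2) :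
    (t.up i).down i = t := by
  refine Prod.ext rfl (Prod.ext ?_ (Finset.erase_insert hi'))
  refine tsub_add_cancel_of_le ?_
  rw [Finsupp.single_le_iff]
  exact Nat.one_le_iff_ne_zero.2 (Finsupp.mem_support_iff.1 hi)

lemma up_down {t : Cell P} {i : Fin (n + 1)} (hi : i ∈ t.2.2) : (t.down i).up i = t :=
  Prod.ext rfl (Prod.ext (add_tsub_cancel_right _ _) (Finset.insert_erase hi))

lemma movable_up {t : Cell P} {i : Fin (n + 1)} (hi : i ∈ t.2.1.support) (hi' : i ∉ t.2.2)
    (him : i ≤ minVar t.1.1) : (t.up i).movable = t.movable := by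
  rw [← movable_down (t := t.up i) (i := i) (Finset.mem_insert_self _ _) him, down_up hi hi']

lemma mdeg_down {t : Cell P} {i : Fin (n + 1)} (hi : i ∈ t.2.2) : (t.down i).mdeg = t.mdeg := by
  rw [mdeg, mdeg, ← Finset.add_sum_erase _ _ hi, ← add_assoc]
  rfl

lemma down_mem_cells {t : Cell P} {i : Fin (n + 1)} {p : ℕ} {j : ℤ} (ht : t ∈ cells P (p + 1) j)
    (hi : i ∈ t.2.2) (him : i ≤ minVar t.1.1) : t.down i ∈ cells P p j := by
  rw [mem_cells] at ht ⊢
  refine ⟨fun l hl => ?_, ?_, ?_⟩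
  · by_cases h : l = i
    · rw [h]; exact him
    · refine ht.1 l ?_
      simpa [down, Finsupp.single_apply, Ne.symm h] using hl
  · rw [down, Finset.card_erase_of_mem hi, ht.2.1, Nat.add_sub_cancel]
  · rw [← ht.2.2, down, map_add, Finsupp.degree_single]
    push_cast
    ring

lemma up_mem_cells {t : Cell P} {i : Fin (n + 1)} {p : ℕ} {j : ℤ} (ht : t ∈ cells P p j)
    (hi : i ∈ t.2.1.support) (hi' : i ∉ t.2.2) : t.up i ∈ cells P (p + 1) j := by
  rw [mem_cells] at ht ⊢
  refine ⟨fun l hl => ht.1 l ?_, ?_, ?_⟩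
  · rw [Finsupp.mem_support_iff] at hl ⊢
    intro h
    exact hl (by rw [up, Finsupp.tsub_apply, h, zero_tsub])
  · rw [up, Finset.card_insert_of_notMem hi', ht.2.1]
  · have h1 : t.2.1.degree = (t.2.1 - Finsupp.single i 1).degree + 1 := by
      conv_lhs => rw [← down_up hi hi']
      rw [down, map_add, Finsupp.degree_single]
      rfl
    rw [← ht.2.2, up, h1]
    push_cast
    ring

lemma top_eq_of_movable_eq {t t' : Cell P} (h : t.movable = t'.movable) : t.top = t'.top := by
  rw [top, h, top]

lemma isUpper_or_isLower {p : ℕ} {j : ℤ} {t : Cell P} (ht : t ∈ cells P p j)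
    (h : t.movable.Nonempty) : t.IsUpper ∨ t.IsLower := by
  obtain ⟨m, hm, hm'⟩ := Finset.exists_mem_eq_sup _ h id
  have hmem : t.top ∈ t.movable := by
    rw [top, hm']
    exact hm
  have hc := (mem_cells.1 ht).1
  by_cases h1 : t.top ∈ t.2.2
  · left
    refine ⟨h1, ?_⟩
    rcases Finset.mem_union.1 hmem with h2 | h2
    · exact hc _ h2
    · exact (Finset.mem_filter.1 h2).2
  · right
    refine ⟨?_, h1⟩
    rcases Finset.mem_union.1 hmem with h2 | h2
    · exact h2
    · exact absurd (Finset.mem_filter.1 h2).1 h1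

end Cell

open Classical in
/-- The cells whose largest movable variable is exterior. -/
def upperCells (P : Finset (Fin (n + 1) →₀ ℕ)) (p : ℕ) (j : ℤ) : Finset (Cell P) :=
  (cells P p j).filter Cell.IsUpper

open Classical in
/-- The cells whose largest movable variable is not exterior. -/
def lowerCells (P : Finset (Fin (n + 1) →₀ ℕ)) (p : ℕ) (j : ℤ) : Finset (Cell P) :=
  (cells P p j).filter Cell.IsLower

open Classical in
/-- The cells without movable variables. -/
def criticalCells (P : Finset (Fin (n + 1) →₀ ℕ)) (p : ℕ) (j : ℤ) : Finset (Cell P) :=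
  (cells P p j).filter fun t => t.movable = ∅

lemma card_cells_le (p : ℕ) (j : ℤ) : (cells P p j).card ≤
    (upperCells P p j).card + (lowerCells P p j).card + (criticalCells P p j).card := by
  classical
  have : cells P p j ⊆ upperCells P p j ∪ lowerCells P p j ∪ criticalCells P p j := by
    intro t ht
    simp only [upperCells, lowerCells, criticalCells, Finset.mem_union, Finset.mem_filter, ht,
      true_and]
    rcases t.movable.eq_empty_or_nonempty with h | h
    · exact Or.inr h
    · exact Or.inl (Cell.isUpper_or_isLower ht h)
  exact (Finset.card_le_card this).trans
    ((Finset.card_union_le _ _).trans (Nat.add_le_add_right (Finset.card_union_le _ _) _))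

/-- Making the largest movable variable exterior is injective, since moving it down again recovers
the cell. -/
lemma card_lowerCells_le (p : ℕ) (j : ℤ) :
    (lowerCells P p j).card ≤ (upperCells P (p + 1) j).card := by
  classical
  have key : ∀ t ∈ lowerCells P p j, (t.up t.top).top = t.top ∧ (t.up t.top).down t.top = t := by
    intro t ht
    simp only [lowerCells, Finset.mem_filter] at ht
    obtain ⟨h1, h2, h3⟩ := ht
    exact ⟨Cell.top_eq_of_movable_eq (Cell.movable_up h2 h3 ((mem_cells.1 h1).1 _ h2)),
      Cell.down_up h2 h3⟩
  refine Finset.card_le_card_of_injOn (fun t => t.up t.top) ?_ ?_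
  · intro t ht
    have h0 := (key t ht).1
    simp only [lowerCells, upperCells, Finset.coe_filter] at ht ⊢
    obtain ⟨h1, h2, h3⟩ := ht
    refine ⟨Cell.up_mem_cells h1 h2 h3, ?_⟩
    rw [Cell.IsUpper, h0]
    exact ⟨Finset.mem_insert_self _ _, (mem_cells.1 h1).1 _ h2⟩
  · intro t ht t' ht' h
    dsimp only at h
    have h0 : t.top = t'.top := by rw [← (key t ht).1, h, (key t' ht').1]
    rw [← (key t ht).2, h, h0, (key t' ht').2]

/-- Without movable variables, $\delta=0$ and $\sigma$ is a $p$-subset of the $n-m$ variables above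
$\min(x^\alpha)=x_m$; the internal degree forces $\deg x^\alpha=j-p$. -/
lemma card_criticalCells_le (P : Finset (Fin (n + 1) →₀ ℕ)) (p : ℕ) (j : ℤ) :
    (criticalCells P p j).card ≤ resRank P p j := by
  classical
  have h1 : resRank P p j = ∑ α ∈ P with ((Finsupp.degree α : ℕ) : ℤ) = j - p,
      (n - (minVar α : ℕ)).choose p := by
    rw [resRank, ← Finset.sum_fiberwise_of_maps_to (g := minVar) (t := Finset.univ)
      fun _ _ => Finset.mem_univ _]
    refine Finset.sum_congr rfl fun i _ => ?_
    rw [Finset.sum_congr rfl (g := fun _ => (n - (i : ℕ)).choose p) fun α hα => by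
      rw [(Finset.mem_filter.1 hα).2], Finset.sum_const, smul_eq_mul, mul_comm, beta,
      Finset.filter_filter]
  have h2 : resRank P p j = ((P.filter fun α => ((Finsupp.degree α : ℕ) : ℤ) = j - p).sigma
      fun α => Finset.powersetCard p (Finset.Ioi (minVar α))).card := by
    rw [h1, Finset.card_sigma]
    refine Finset.sum_congr rfl fun α _ => ?_
    rw [Finset.card_powersetCard, Fin.card_Ioi]
    congr 1
  rw [h2]
  have key : ∀ t ∈ criticalCells P p j, t.2.1 = 0 ∧ (∀ l ∈ t.2.2, minVar t.1.1 < l) ∧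
      t ∈ cells P p j := by
    intro t ht
    simp only [criticalCells, Finset.mem_filter, Cell.movable, Finset.union_eq_empty,
      Finsupp.support_eq_empty, Finset.filter_eq_empty_iff, not_le] at ht
    exact ⟨ht.2.1, ht.2.2, ht.1⟩
  refine Finset.card_le_card_of_injOn (fun t => ⟨t.1.1, t.2.2⟩) ?_ ?_
  · intro t ht
    obtain ⟨h3, h4, h5⟩ := key t ht
    rw [mem_cells, h3] at h5
    simp only [Finset.mem_coe, Finset.mem_sigma, Finset.mem_filter, Finset.mem_powersetCard]
    refine ⟨⟨t.1.2, ?_⟩, fun l hl => Finset.mem_Ioi.2 (h4 l hl), h5.2.1⟩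
    have := h5.2.2
    simp only [map_zero, zero_add] at this
    push_cast at this
    linarith
  · intro t ht t' ht' h
    simp only [Sigma.mk.injEq, heq_eq_eq] at h
    exact Prod.ext (Subtype.ext h.1)
      (Prod.ext ((key t ht).1.trans (key t' ht').1.symm) h.2)

/-- The boundaries of the upper cells are independent: the functional dual to the lower partner of
each cell makes them triangular for the colexicographic order of the multidegree of $x^\delta
e_\sigma$. -/
lemma card_upperCells_le (hP : IsPommaretBasis P J) (hf : IsMarkedBasis P J f) (p : ℕ) (j : ℤ) :
    (upperCells P p j).card ≤
      Module.finrank k ((idealPart (Ideal.span (Set.range f)) p j).map (koszulₗ n k (Fin 1))) := by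
  classical
  cases p with
  | zero =>
    have : upperCells P 0 j = ∅ := by
      rw [upperCells, Finset.filter_eq_empty_iff]
      intro t ht h
      have := (mem_cells.1 ht).2.1
      rw [Finset.card_eq_zero] at this
      rw [Cell.IsUpper, this] at h
      exact absurd h.1 (Finset.notMem_empty _)
    rw [this]
    exact Nat.zero_le _
  | succ p =>
    obtain ⟨l, hl1, hl0⟩ := exists_dual_family (linearIndependent_cellVec hP hf.isMarkedSet p j)
    have hup : ∀ u : upperCells P (p + 1) j, u.1 ∈ cells P (p + 1) j ∧ u.1.IsUpper := fun u =>
      Finset.mem_filter.1 u.2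
    let dn : upperCells P (p + 1) j → cells P p j := fun u =>
      ⟨u.1.down u.1.top, Cell.down_mem_cells (hup u).1 (hup u).2.1 (hup u).2.2⟩
    have htop : ∀ u, (dn u).1.top = u.1.top := fun u =>
      Cell.top_eq_of_movable_eq (Cell.movable_down (hup u).2.1 (hup u).2.2)
    -- the summand of the boundary of `u` that belongs to the variable `x_i`
    have hterm : ∀ (u u' : upperCells P (p + 1) j), ∀ i ∈ u'.1.2.2,
        l (dn u) (koszulSingle k (u'.1.2.2.erase i) (koszulSign k i (u'.1.2.2.erase i) *
          (X i * (monomial u'.1.2.1 1 * f u'.1.1)))) ≠ 0 →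
        (i = u'.1.top ∧ u' = u) ∨ toColex u.1.mdeg < toColex u'.1.mdeg := by
      intro u u' i hi hne
      obtain ⟨c, -, hc⟩ := koszulSign_mul_eq_smul (k := k) i (u'.1.2.2.erase i)
      rw [hc, map_smul, map_smul] at hne
      have hne := right_ne_zero_of_smul hne
      obtain ⟨h1, h2, h3⟩ := mem_cells.1 (hup u').1
      rcases le_or_gt i (minVar u'.1.1.1) with him | him
      · left
        have h4 : koszulSingle k (u'.1.2.2.erase i) (X i * (monomial u'.1.2.1 1 * f u'.1.1)) =
            cellVec f (u'.1.down i) := by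
          rw [cellVec, Cell.down, ← mul_assoc, X, monomial_mul, one_mul, add_comm u'.1.2.1]
        rw [h4] at hne
        have h5 : dn u = ⟨u'.1.down i, Cell.down_mem_cells (hup u').1 hi him⟩ := by
          by_contra h5
          exact hne (hl0 _ _ h5)
        have h6 : (u'.1.down i).top = u'.1.top :=
          Cell.top_eq_of_movable_eq (Cell.movable_down hi him)
        have h7 : u.1.down u.1.top = u'.1.down i := congrArg Subtype.val h5
        have h8 : u.1.top = u'.1.top := by
          rw [← htop u, h5, h6]
        -- Removing any variable but the largest movable one leaves that one exterior, whereas in a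
        -- lower partner it has been removed.
        have h9 : i = u'.1.top := by
          by_contra h9
          have h10 : u'.1.top ∈ (u'.1.down i).2.2 :=
            Finset.mem_erase.2 ⟨Ne.symm h9, (hup u').2.1⟩
          rw [← h7, ← h8] at h10
          exact absurd rfl (Finset.mem_erase.1 h10).1
        refine ⟨h9, Subtype.ext ?_⟩
        rw [← Cell.up_down (hup u).2.1, ← Cell.up_down (hup u').2.1, h7, ← h9, h8, h9]
      · right
        -- A non-multiplicative variable is rewritten with smaller multipliers and unchanged
        -- exterior part, so the multidegree drops.
        have h4 := koszulSingle_mem_span (σ := u'.1.2.2.erase i) (p := p) (j := j)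
          (by rw [Finset.card_erase_of_mem hi, h2, Nat.add_sub_cancel])
          (by push_cast at h3 ⊢; linarith)
          (hf.X_mul_mem_coneSpan hP (α := u'.1.1) (δ := u'.1.2.1) him)
        obtain ⟨h5, h6⟩ := mem_of_apply_span_ne_zero (fun t ht => hl0 _ t ht) h4 hne
        rw [← Cell.mdeg_down (hup u).2.1]
        change toColex ((dn u).1.2.1 + ∑ l ∈ (dn u).1.2.2, Finsupp.single l 1) < _
        rw [h6, Cell.mdeg, ← Finset.add_sum_erase _ _ hi, ← add_assoc, toColex_add, toColex_add]
        exact add_lt_add_left h5 _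
    have hli : LinearIndependent k fun u : upperCells P (p + 1) j =>
        koszulₗ n k (Fin 1) (cellVec f u) := by
      refine linearIndependent_of_triangular _ (fun u => l (dn u)) (fun u => toColex u.1.mdeg)
        (fun u => ?_) fun u u' h => ?_
      · rw [LinearMap.restrictScalars_apply, cellVec, koszul_koszulSingle, map_sum,
          Finset.sum_eq_single_of_mem _ (hup u).2.1]
        · obtain ⟨c, hc0, hc⟩ := koszulSign_mul_eq_smul (k := k) u.1.top (u.1.2.2.erase u.1.top)
          have h4 : koszulSingle k (u.1.2.2.erase u.1.top)
              (X u.1.top * (monomial u.1.2.1 1 * f u.1.1)) = cellVec f (dn u) := by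
            rw [cellVec, ← mul_assoc, X, monomial_mul, one_mul, add_comm _ u.1.2.1]
            rfl
          rw [hc, map_smul, map_smul, h4, hl1]
          simpa using hc0
        · intro i hi hne
          by_contra h
          rcases hterm u u i hi h with h1 | h1
          · exact hne h1.1
          · exact absurd h1 (lt_irrefl _)
      · rw [LinearMap.restrictScalars_apply, cellVec, koszul_koszulSingle, map_sum] at h
        obtain ⟨i, hi, hne⟩ := Finset.exists_ne_zero_of_sum_ne_zero h
        exact (hterm u u' i hi hne).imp_left And.right
    have hmem : ∀ u : upperCells P (p + 1) j, koszulₗ n k (Fin 1) (cellVec f u) ∈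
        (idealPart (Ideal.span (Set.range f)) (p + 1) j).map (koszulₗ n k (Fin 1)) := fun u => by
      refine ⟨_, ?_, rfl⟩
      rw [SetLike.mem_coe, ← span_cellVec hP hf]
      exact Submodule.subset_span ⟨⟨u.1, (hup u).1⟩, rfl⟩
    have : FiniteDimensional k (idealPart (Ideal.span (Set.range f)) (p + 1) j) := by
      rw [← span_cellVec hP hf]
      exact FiniteDimensional.span_of_finite k (Set.finite_range _)
    have hli' : LinearIndependent k fun u : upperCells P (p + 1) j =>
        (⟨_, hmem u⟩ : (idealPart (Ideal.span (Set.range f)) (p + 1) j).map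
          (koszulₗ n k (Fin 1))) :=
      LinearIndependent.of_comp (Submodule.subtype _) hli
    simpa using hli'.fintype_card_le_finrank

/-- The Koszul homology of an ideal with a marked basis is bounded by the number of critical
cells. -/
theorem finrank_idealHomology_le (hP : IsPommaretBasis P J) (hf : IsMarkedBasis P J f) (p : ℕ)
    (j : ℤ) :
    Module.finrank k (IdealHomology (Ideal.span (Set.range f)) p j) ≤ resRank P p j := by
  have hfin : FiniteDimensional k (idealPart (Ideal.span (Set.range f)) p j) := by
    rw [← span_cellVec hP hf]
    exact FiniteDimensional.span_of_finite k (Set.finite_range _)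
  have h1 : Module.finrank k (IdealHomology (Ideal.span (Set.range f)) p j) + _ + _ = _ :=
    finrank_homologyOf_add (d := koszulₗ n k (Fin 1))
    (Z₁ := idealPart (Ideal.span (Set.range f)) (p + 1) j)
    (Z₀ := idealPart (Ideal.span (Set.range f)) p j)
    (fun z hz => koszul_mem_idealPart hz) fun z => koszul_koszul z
  have h2 : Module.finrank k (idealPart (Ideal.span (Set.range f)) p j) = (cells P p j).card := by
    rw [← span_cellVec hP hf, finrank_span_eq_card (linearIndependent_cellVec hP hf.isMarkedSet p j),
      Fintype.card_coe]
  have h3 := card_upperCells_le hP hf p j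
  have h4 := card_upperCells_le hP hf (p + 1) j
  have h5 := card_lowerCells_le (P := P) p j
  have h6 := card_criticalCells_le P p j
  have h7 := card_cells_le (P := P) p j
  -- $\dim
  -- H_p=|\mathrm{cells}_p|-\operatorname{rk}d_p-\operatorname{rk}d_{p+1}\le|\mathrm{cells}_p|-|\mathrm{upper}_p|-|\mathrm{upper}_{p+1}|$,
  -- and $|\mathrm{upper}_{p+1}|\ge|\mathrm{lower}_p|$ leaves at most the critical cells.
  omega

end Morse

/-! ### Nonvanishing Koszul homology of a quasi-stable ideal -/

section LowerBound

variable {n : ℕ} {k : Type*} [Field k] {P : Finset (Fin (n + 1) →₀ ℕ)}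
  {J : Ideal (MvPolynomial (Fin (n + 1)) k)}

lemma IsPommaretBasis.mem_termsOf_of_mem_support (hP : IsPommaretBasis P J)
    {p : MvPolynomial (Fin (n + 1)) k} (hp : p ∈ J) {γ : Fin (n + 1) →₀ ℕ} (hγ : γ ∈ p.support) :
    γ ∈ termsOf J := by
  rw [hP.mem_termsOf_iff]
  rw [hP.span_eq, mem_ideal_span_monomial_image] at hp
  exact hp γ hγ

lemma IsPommaretBasis.mem_termsOf_of_le (hP : IsPommaretBasis P J) {γ γ' : Fin (n + 1) →₀ ℕ}
    (h : γ ∈ termsOf J) (hle : γ ≤ γ') : γ' ∈ termsOf J := by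
  rw [hP.mem_termsOf_iff] at *
  obtain ⟨α, hα, h1⟩ := h
  exact ⟨α, hα, h1.trans hle⟩

/-- If $x^\alpha/\min(x^\alpha)$ were in the cone of some $x^\beta$, so would be $x^\alpha$, because
$\min(x^\alpha)\le\min(x^\beta)$. Disjointness gives $\alpha=\beta$, but $x^\beta$ properly divides
$x^\alpha$. -/
lemma IsPommaretBasis.sub_single_not_mem (hP : IsPommaretBasis P J) {α : Fin (n + 1) →₀ ℕ}
    (hα : α ∈ P) (h0 : α ≠ 0) : α - Finsupp.single (minVar α) 1 ∉ termsOf J := by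
  intro h
  obtain ⟨β, hβ, δ, hδ, heq⟩ := hP.exists_cone h
  have hα1 : α - Finsupp.single (minVar α) 1 + Finsupp.single (minVar α) 1 = α := by
    refine tsub_add_cancel_of_le ?_
    rw [Finsupp.single_le_iff]
    exact Nat.one_le_iff_ne_zero.2 (Finsupp.mem_support_iff.1 (minVar_mem_support h0))
  have hα2 : α = β + (δ + Finsupp.single (minVar α) 1) := by
    rw [← add_assoc, ← heq, hα1]
  have hle : minVar α ≤ minVar β := by
    by_contra hlt
    have hβ0 : β ≠ 0 := by
      rintro rfl
      exact hlt (by simpa [minVar] using Fin.le_last _)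
    have h1 := minVar_mem_support hβ0
    rw [Finsupp.mem_support_iff] at h1
    have h2 := apply_eq_zero_of_lt_minVar (not_le.1 hlt)
    rw [hα2, Finsupp.add_apply] at h2
    omega
  have h3 : α ∈ pommaretCone β := by
    refine ⟨_, fun i hi => ?_, hα2⟩
    by_cases h4 : i = minVar α
    · rw [h4]; exact hle
    · refine hδ i ?_
      rw [Finsupp.mem_support_iff, Finsupp.add_apply, Finsupp.single_eq_of_ne h4, add_zero] at hi
      exact Finsupp.mem_support_iff.2 hi
  have h4 := hP.eq_of_mem_cone hα hβ (IsPommaretBasis.self_mem_cone α) h3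
  rw [← h4] at hα2
  have h5 := left_eq_add.1 hα2
  have h6 := DFunLike.congr_fun h5 (minVar α)
  simp at h6

/-- A term outside a quasi-stable ideal all of whose multiples by the variables from
`min(x^α)` on lie in the ideal. -/
lemma IsPommaretBasis.exists_socle_term (hP : IsPommaretBasis P J)
    (hqs : ∀ α ∈ termsOf J, ∀ j : Fin (n + 1), minVar α < j →
      ∃ s : ℕ, α - Finsupp.single (minVar α) 1 + Finsupp.single j s ∈ termsOf J)
    {α : Fin (n + 1) →₀ ℕ} (hα : α ∈ P) (h0 : α ≠ 0) :
    ∃ γ : Fin (n + 1) →₀ ℕ, γ ∉ termsOf J ∧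
      (∀ j, minVar α ≤ j → γ + Finsupp.single j 1 ∈ termsOf J) ∧ (∀ i, i < minVar α → γ i = 0) ∧
      α.degree ≤ γ.degree + 1 := by
  have hαJ : α ∈ termsOf J := hP.mem_termsOf_of_mem_cone hα (IsPommaretBasis.self_mem_cone α)
  have hα1 : α - Finsupp.single (minVar α) 1 + Finsupp.single (minVar α) 1 = α := by
    refine tsub_add_cancel_of_le ?_
    rw [Finsupp.single_le_iff]
    exact Nat.one_le_iff_ne_zero.2 (Finsupp.mem_support_iff.1 (minVar_mem_support h0))
  set α' := α - Finsupp.single (minVar α) 1 with hα'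
  have hs : ∀ j, ∃ s : ℕ, minVar α < j → α' + Finsupp.single j s ∈ termsOf J := by
    intro j
    by_cases hj : minVar α < j
    · obtain ⟨s, hs⟩ := hqs α hαJ j hj
      exact ⟨s, fun _ => hs⟩
    · exact ⟨0, fun h => absurd h hj⟩
  choose s hs using hs
  -- Quasi-stability bounds every exponent, so $M$ is finite; an element of maximal degree yields
  -- the required term.
  let M : Set (Fin (n + 1) →₀ ℕ) := {ε | (∀ i ∈ ε.support, minVar α < i) ∧ α' + ε ∉ termsOf J}
  have hM : M.Finite := by
    refine (Set.finite_Icc (0 : Fin (n + 1) →₀ ℕ) (Finsupp.equivFunOnFinite.symm s)).subset ?_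
    rintro ε ⟨h1, h2⟩
    refine ⟨zero_le, fun i => ?_⟩
    by_contra hlt
    rw [not_le, Finsupp.equivFunOnFinite_symm_apply_apply] at hlt
    refine h2 (hP.mem_termsOf_of_le
      (hs i (h1 i (Finsupp.mem_support_iff.2 (Nat.ne_zero_of_lt hlt)))) ?_)
    exact add_le_add le_rfl (Finsupp.single_le_iff.2 hlt.le)
  have hM0 : (0 : Fin (n + 1) →₀ ℕ) ∈ M :=
    ⟨by simp, by rw [add_zero]; exact hP.sub_single_not_mem hα h0⟩
  obtain ⟨ε, ⟨hε1, hε2⟩, hmax⟩ := Set.exists_max_image M (fun ε => ε.degree) hM ⟨0, hM0⟩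
  have hε0 : ∀ i, i ≤ minVar α → ε i = 0 := by
    intro i hi
    by_contra h
    exact absurd (hε1 i (Finsupp.mem_support_iff.2 h)) (not_lt.2 hi)
  refine ⟨α' + ε, hε2, fun j hj => ?_, fun i hi => ?_, ?_⟩
  · rcases hj.lt_or_eq with h1 | h1
    · by_contra h2
      have h3 : ε + Finsupp.single j 1 ∈ M := by
        refine ⟨fun i hi => ?_, by rwa [← add_assoc]⟩
        by_cases hij : i = j
        · rwa [hij]
        · rw [Finsupp.mem_support_iff, Finsupp.add_apply, Finsupp.single_eq_of_ne hij,
            add_zero] at hi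
          exact hε1 i (Finsupp.mem_support_iff.2 hi)
      have h4 := hmax _ h3
      simp only [map_add, Finsupp.degree_single] at h4
      omega
    · rw [← h1, add_right_comm, hα1]
      exact hP.mem_termsOf_of_le hαJ le_self_add
  · rw [Finsupp.add_apply, hε0 i hi.le, hα', Finsupp.tsub_apply, apply_eq_zero_of_lt_minVar hi,
      zero_tsub]
  · have h1 := congrArg Finsupp.degree hα1
    rw [map_add, Finsupp.degree_single] at h1
    rw [map_add]
    omega

lemma koszulSingle_mem_koszulPart {σ : Finset (Fin (n + 1))} {p : ℕ} {j : ℤ}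
    {g : MvPolynomial (Fin (n + 1)) k} (hσ : σ.card = p) (hg : IsHomogeneousInt g (j - p)) :
    koszulSingle k σ g ∈ koszulPart (fun _ => 0) p j := by
  refine fun τ => ⟨fun a => ?_, fun hτ => ?_⟩
  · rw [koszulSingle_apply, sub_zero]
    split_ifs
    · exact hg
    · exact isHomogeneousInt_zero _
  · ext1 a
    rw [koszulSingle_apply, if_neg, Pi.zero_apply]
    rintro rfl
    exact hτ hσ

lemma koszulSingle_mem_idealPart {I : Ideal (MvPolynomial (Fin (n + 1)) k)}
    {σ : Finset (Fin (n + 1))} {p : ℕ} {j : ℤ} {g : MvPolynomial (Fin (n + 1)) k}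
    (hσ : σ.card = p) (hg : IsHomogeneousInt g (j - p)) (hgI : g ∈ I) :
    koszulSingle k σ g ∈ idealPart I p j := by
  refine mem_idealPart.2 ⟨koszulSingle_mem_koszulPart hσ hg, fun τ => ?_⟩
  rw [koszulSingle_apply]
  split_ifs
  · exact hgI
  · exact I.zero_mem

lemma not_subsingleton_homologyOf {V : Type*} [AddCommGroup V] [Module k V] {d : V →ₗ[k] V}
    {Z₁ Z₀ : Submodule k V} {z : V} (hz : z ∈ Z₀) (hdz : d z = 0) (h : ∀ w ∈ Z₁, d w ≠ z) :
    ¬ Subsingleton (HomologyOf d Z₁ Z₀) := by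
  intro hs
  have h1 := Subsingleton.elim (toHomologyOf d Z₁ Z₀ (Z₀ ⊓ LinearMap.ker d).subtype
    (fun w => w.2) ⟨z, hz, hdz⟩) 0
  obtain ⟨w, hw, hwz⟩ := toHomologyOf_eq_zero_iff.1 h1
  exact h w hw hwz

/-- A quasi-stable ideal has a nonzero Koszul homology class for every element of its Pommaret
basis. -/
theorem IsPommaretBasis.exists_not_subsingleton (hP : IsPommaretBasis P J)
    (hqs : ∀ α ∈ termsOf J, ∀ j : Fin (n + 1), minVar α < j →
      ∃ s : ℕ, α - Finsupp.single (minVar α) 1 + Finsupp.single j s ∈ termsOf J)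
    {α : Fin (n + 1) →₀ ℕ} (hα : α ∈ P) :
    ∃ j : ℤ, (α.degree : ℤ) ≤ j - (n - minVar α : ℕ) ∧
      ¬ Subsingleton (IdealHomology J (n - minVar α) j) := by
  -- For $x^\alpha=1$ the ideal is $S$ and the class of $1$ in homological degree $0$ is not a
  -- boundary.
  by_cases h0 : α = 0
  · subst h0
    have h1 : n - (minVar (0 : Fin (n + 1) →₀ ℕ) : ℕ) = 0 := by simp [minVar]
    rw [h1]
    refine ⟨0, by simp, not_subsingleton_homologyOf (z := koszulSingle k ∅ 1)
      (koszulSingle_mem_idealPart Finset.card_empty ?_ ?_) ?_ fun w hw hwz => ?_⟩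
    · simpa using isHomogeneousInt_of_isHomogeneous (isHomogeneous_one (Fin (n + 1)) k)
    · rw [hP.span_eq]
      exact Ideal.subset_span ⟨0, hα, rfl⟩
    · rw [LinearMap.restrictScalars_apply, koszul_koszulSingle, Finset.sum_empty]
    · have h2 := congrArg (fun z => constantCoeff (z ∅ 0)) hwz
      simp only [LinearMap.restrictScalars_apply, koszulSingle_apply] at h2
      rw [GradedExactSeq.constantCoeff_koszul, if_true, map_one] at h2
      exact zero_ne_one h2
  · obtain ⟨γ, hγ, hmul, hγ0, hdeg⟩ := hP.exists_socle_term hqs hα h0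
    set m := minVar α with hm
    have hmn : (m : ℕ) ≤ n := Nat.lt_succ_iff.1 m.2
    have hcard : (Finset.Ici m).card = n - m + 1 := by
      rw [Fin.card_Ici]
      omega
    have hx : koszulSingle k (Finset.Ici m) (monomial γ 1) ∈
        koszulPart (fun _ => 0) (n - m + 1) ((γ.degree : ℤ) + (n - m + 1 : ℕ)) := by
      refine koszulSingle_mem_koszulPart hcard ?_
      rw [add_sub_cancel_right]
      exact isHomogeneousInt_of_isHomogeneous (isHomogeneous_monomial _ rfl)
    -- The boundary of $x^\gamma e_{\{m,\dots,n\}}$ has homological degree $n-m$, so $j-(n-m)=\deg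
    -- x^\gamma+1\ge\deg x^\alpha$.
    refine ⟨γ.degree + (n - m + 1 : ℕ), by push_cast; omega,
      not_subsingleton_homologyOf (z := koszul (k := k)
        (koszulSingle k (Finset.Ici m) (monomial γ 1)))
        (mem_idealPart.2 ⟨koszul_mem hx, fun σ => ?_⟩) (koszul_koszul _) fun w hw hwz => ?_⟩
    · rw [koszul_koszulSingle, Finset.sum_apply, Finset.sum_apply]
      refine J.sum_mem fun i hi => ?_
      rw [koszulSingle_apply]
      split_ifs
      · refine J.mul_mem_left _ ?_
        rw [X, monomial_mul, one_mul, add_comm _ γ]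
        exact hmul i (Finset.mem_Ici.1 hi)
      · exact J.zero_mem
    · rw [mem_idealPart] at hw
      -- If $w$ with entries in $J$ had the same boundary, $x^\gamma e_{\{m,\dots,n\}}-w$ would be a
      -- boundary over $S$. Its coefficient at $x^\gamma e_{\{m,\dots,n\}}$ is $1$, but boundaries
      -- contribute there only multiples of $x_i$ with $i<m$, which do not divide $x^\gamma$.
      have h1 := Submodule.sub_mem _ hx hw.1
      obtain ⟨v, -, hv⟩ := exists_koszul_eq_of_mem h1 (by
        rw [map_sub, sub_eq_zero]; exact hwz.symm) fun a =>
          GradedExactSeq.constantCoeff_eq_zero_of_mem h1 a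
      have h2 := congrArg (fun z => coeff γ (z (Finset.Ici m) 0)) hv
      simp only [Pi.sub_apply, koszulSingle_apply, if_true, coeff_sub, coeff_monomial] at h2
      have h3 : coeff γ (w (Finset.Ici m) 0) = 0 := by
        by_contra h
        exact hγ (hP.mem_termsOf_of_mem_support (hw.2 _) (mem_support_iff.2 h))
      rw [h3, sub_zero, koszul_apply, Finset.sum_apply, coeff_sum, Finset.sum_eq_zero] at h2
      · exact zero_ne_one h2
      · intro i hi
        rw [Finset.mem_compl, Finset.mem_Ici, not_le] at hi
        rw [Pi.smul_apply, smul_eq_mul, mul_comm (koszulSign k i _), mul_assoc, coeff_X_mul',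
          if_neg]
        rw [Finsupp.mem_support_iff, not_not]
        exact hγ0 i hi

end LowerBound

/-! ### Complements of the ideals as $A$-modules -/

section Complement

variable {n : ℕ} {A : Type*} [CommRing A] {P : Finset (Fin (n + 1) →₀ ℕ)}
  {J : Ideal (MvPolynomial (Fin (n + 1)) A)}

/-- The `A`-module generated by all terms that do not lie in `J`. -/
def complement (J : Ideal (MvPolynomial (Fin (n + 1)) A)) :
    Submodule A (MvPolynomial (Fin (n + 1)) A) :=
  Submodule.span A ((fun γ => monomial γ (1 : A)) '' {γ | γ ∉ termsOf J})

lemma mem_span_monomial_iff {T : Set (Fin (n + 1) →₀ ℕ)} {p : MvPolynomial (Fin (n + 1)) A} :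
    p ∈ Submodule.span A ((fun γ => monomial γ (1 : A)) '' T) ↔ ∀ γ ∈ p.support, γ ∈ T := by
  constructor
  · intro hp
    induction hp using Submodule.span_induction with
    | mem x hx =>
      obtain ⟨γ, hγ, rfl⟩ := hx
      intro η hη
      have := support_monomial_subset hη
      rw [Finset.mem_singleton] at this
      rwa [this]
    | zero => simp
    | add x y _ _ hx hy =>
      intro γ hγ
      rcases Finset.mem_union.1 (support_add hγ) with h | h
      · exact hx γ h
      · exact hy γ h
    | smul c x _ hx => exact fun γ hγ => hx γ (support_smul hγ)
  · exact fun h => mem_of_forall_monomial_mem fun γ hγ => Submodule.subset_span ⟨γ, h γ hγ, rfl⟩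

lemma mem_complement_iff {p : MvPolynomial (Fin (n + 1)) A} :
    p ∈ complement J ↔ ∀ γ ∈ p.support, γ ∉ termsOf J :=
  mem_span_monomial_iff

lemma mem_complementComponent_iff {s : ℕ} {p : MvPolynomial (Fin (n + 1)) A} :
    p ∈ complementComponent J s ↔ ∀ γ ∈ p.support, γ ∉ termsOf J ∧ γ.degree = s :=
  mem_span_monomial_iff

/-- The ideal is homogeneous, so the degreewise decompositions glue. -/
lemma IsMarkedBasis.isCompl {f : P → MvPolynomial (Fin (n + 1)) A} (hf : IsMarkedBasis P J f) :
    IsCompl ((Ideal.span (Set.range f)).restrictScalars A) (complement J) := by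
  let _ := MvPolynomial.gradedAlgebra (σ := Fin (n + 1)) (R := A)
  have hhom : (Ideal.span (Set.range f)).IsHomogeneous (homogeneousSubmodule (Fin (n + 1)) A) := by
    refine Ideal.homogeneous_span _ _ ?_
    rintro _ ⟨α, rfl⟩
    exact ⟨_, hf.isMarkedSet.homogeneous α⟩
  constructor
  · rw [Submodule.disjoint_def]
    intro x hx hx'
    rw [← sum_homogeneousComponent x]
    refine Finset.sum_eq_zero fun s _ => Submodule.disjoint_def.1 (hf.disjoint s) _
      ⟨homogeneousComponent_mem_of_mem hhom hx s, homogeneousComponent_mem s x⟩ ?_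
    rw [mem_complementComponent_iff]
    intro γ hγ
    rw [mem_support_iff, coeff_homogeneousComponent] at hγ
    split_ifs at hγ with h
    · exact ⟨mem_complement_iff.1 hx' γ (mem_support_iff.2 hγ), h⟩
    · exact absurd rfl hγ
  · rw [codisjoint_iff, eq_top_iff]
    intro p _
    refine mem_of_forall_monomial_mem fun γ _ => ?_
    have h1 : monomial γ (1 : A) ∈ homogeneousSubmodule (Fin (n + 1)) A γ.degree :=
      isHomogeneous_monomial _ rfl
    rw [← hf.sup_eq] at h1
    have h2 : complementComponent J γ.degree ≤ complement J := fun p hp =>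
      mem_complement_iff.2 fun η hη => (mem_complementComponent_iff.1 hp η hη).1
    have h3 : idealComponent (Ideal.span (Set.range f)) γ.degree ≤
        (Ideal.span (Set.range f)).restrictScalars A := inf_le_left
    exact sup_le_sup h3 h2 h1

lemma IsPommaretBasis.isCompl [Nontrivial A] (hP : IsPommaretBasis P J) :
    IsCompl (J.restrictScalars A) (complement J) := by
  constructor
  · rw [Submodule.disjoint_def]
    intro x hx hx'
    by_contra h
    obtain ⟨γ, hγ⟩ := support_nonempty.2 h
    refine mem_complement_iff.1 hx' γ hγ (hP.mem_termsOf_iff.2 ?_)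
    rw [Submodule.restrictScalars_mem, hP.span_eq, mem_ideal_span_monomial_image] at hx
    exact hx γ hγ
  · rw [codisjoint_iff, eq_top_iff]
    intro p _
    refine mem_of_forall_monomial_mem fun γ _ => ?_
    by_cases h : γ ∈ termsOf J
    · exact Submodule.mem_sup_left h
    · exact Submodule.mem_sup_right (mem_complement_iff.2 fun η hη => by
        have := support_monomial_subset hη
        rw [Finset.mem_singleton] at this
        rwa [this])

end Complement

/-! ### Base change to a residue field -/

section BaseChange

variable {n : ℕ} {A : Type*} [CommRing A] {k : Type*} [Field k] (π : A →+* k)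
  {ι ι' ι'' : Type*}

/-- Coefficientwise application of a ring homomorphism to vectors of polynomials. -/
def mapVec (v : ι → MvPolynomial (Fin (n + 1)) A) : ι → MvPolynomial (Fin (n + 1)) k :=
  fun a => MvPolynomial.map π (v a)

variable {π}

lemma mapVec_sub (v w : ι → MvPolynomial (Fin (n + 1)) A) :
    mapVec π (v - w) = mapVec π v - mapVec π w := by
  ext1 a
  simp [mapVec]

lemma mapVec_surjective (hπ : Function.Surjective π) :
    Function.Surjective (mapVec π : (ι → MvPolynomial (Fin (n + 1)) A) → _) := by
  intro v
  choose w hw using fun a => MvPolynomial.map_surjective (σ := Fin (n + 1)) π hπ (v a)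
  exact ⟨w, funext hw⟩

lemma mapVec_eq_zero_iff [Fintype ι] {v : ι → MvPolynomial (Fin (n + 1)) A} :
    mapVec π v = 0 ↔ v ∈ RingHom.ker π • (⊤ : Submodule A (ι → MvPolynomial (Fin (n + 1)) A)) := by
  classical
  constructor
  · intro h
    have h1 : v = ∑ a, ∑ γ ∈ (v a).support, coeff γ (v a) •
        (Pi.single a (monomial γ 1) : ι → MvPolynomial (Fin (n + 1)) A) := by
      ext1 b
      simp only [Finset.sum_apply, Pi.smul_apply, Pi.single_apply, smul_ite, smul_zero,
        Finset.sum_ite_irrel, Finset.sum_const_zero]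
      rw [Finset.sum_ite_eq, if_pos (Finset.mem_univ _)]
      simp only [smul_monomial, smul_eq_mul, mul_one]
      exact (v b).as_sum
    rw [h1]
    refine Submodule.sum_mem _ fun a _ => Submodule.sum_mem _ fun γ _ =>
      Submodule.smul_mem_smul ?_ trivial
    have h2 := congrArg (coeff γ) (congrFun h a)
    rwa [mapVec, coeff_map, Pi.zero_apply, coeff_zero] at h2
  · intro h
    induction h using Submodule.smul_induction_on' with
    | smul c hc w _ =>
      ext1 a
      rw [mapVec, Pi.smul_apply, smul_eq_C_mul, map_mul, map_C, (RingHom.mem_ker).1 hc, map_zero,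
        zero_mul, Pi.zero_apply]
    | add x _ y _ hx hy =>
      ext1 a
      have h1 := congrFun hx a
      have h2 := congrFun hy a
      rw [mapVec] at *
      rw [Pi.add_apply, map_add, h1, h2, Pi.zero_apply, add_zero]

/-- The kernel of reduction is $\ker\pi$ times the free module, which every $A$-linear map respects.
Linearity over $S$ is not needed, so the splittings qualify. -/
lemma mapVec_linearMap_eq_zero [Fintype ι] [Fintype ι']
    (s : (ι → MvPolynomial (Fin (n + 1)) A) →ₗ[A] (ι' → MvPolynomial (Fin (n + 1)) A))
    {v : ι → MvPolynomial (Fin (n + 1)) A} (hv : mapVec π v = 0) : mapVec π (s v) = 0 := by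
  rw [mapVec_eq_zero_iff] at hv ⊢
  have h1 := Submodule.mem_map_of_mem (f := s) hv
  rw [Submodule.map_smul''] at h1
  exact Submodule.smul_mono le_rfl le_top h1

variable (π)

/-- Base change of a linear map of free modules over polynomial rings. -/
def mapLin [Fintype ι] [DecidableEq ι]
    (φ : (ι → MvPolynomial (Fin (n + 1)) A) →ₗ[MvPolynomial (Fin (n + 1)) A]
      (ι' → MvPolynomial (Fin (n + 1)) A)) :
    (ι → MvPolynomial (Fin (n + 1)) k) →ₗ[MvPolynomial (Fin (n + 1)) k]
      (ι' → MvPolynomial (Fin (n + 1)) k) where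
  toFun v b := ∑ a, MvPolynomial.map π (φ (Pi.single a 1) b) * v a
  map_add' v w := by
    ext1 b
    simp [mul_add, Finset.sum_add_distrib]
  map_smul' c v := by
    ext1 b
    simp only [Pi.smul_apply, smul_eq_mul, RingHom.id_apply, Finset.mul_sum]
    exact Finset.sum_congr rfl fun a _ => by ring

variable {π}

lemma mapLin_apply [Fintype ι] [DecidableEq ι]
    (φ : (ι → MvPolynomial (Fin (n + 1)) A) →ₗ[MvPolynomial (Fin (n + 1)) A]
      (ι' → MvPolynomial (Fin (n + 1)) A)) (v : ι → MvPolynomial (Fin (n + 1)) k) (b : ι') :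
    mapLin π φ v b = ∑ a, MvPolynomial.map π (φ (Pi.single a 1) b) * v a := rfl

lemma mapLin_mapVec [Fintype ι] [DecidableEq ι]
    (φ : (ι → MvPolynomial (Fin (n + 1)) A) →ₗ[MvPolynomial (Fin (n + 1)) A]
      (ι' → MvPolynomial (Fin (n + 1)) A)) (v : ι → MvPolynomial (Fin (n + 1)) A) :
    mapLin π φ (mapVec π v) = mapVec π (φ v) := by
  ext1 b
  rw [mapLin_apply, mapVec, linearMap_pi_apply φ v, map_sum]
  exact Finset.sum_congr rfl fun a _ => (map_mul _ _ _).symm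

lemma mapLin_single [Fintype ι] [DecidableEq ι]
    (φ : (ι → MvPolynomial (Fin (n + 1)) A) →ₗ[MvPolynomial (Fin (n + 1)) A]
      (ι' → MvPolynomial (Fin (n + 1)) A)) (a : ι) (b : ι') :
    mapLin π φ (Pi.single a 1) b = MvPolynomial.map π (φ (Pi.single a 1) b) := by
  rw [mapLin_apply, Finset.sum_eq_single a]
  · simp
  · intro a' _ h
    rw [Pi.single_eq_of_ne h, mul_zero]
  · simp

lemma IsHomogeneousInt.map {p : MvPolynomial (Fin (n + 1)) A} {e : ℤ} (h : IsHomogeneousInt p e) :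
    IsHomogeneousInt (MvPolynomial.map π p) e :=
  fun γ hγ => h γ (support_map_subset π p hγ)

/-- If $\psi(v)$ reduces to zero, so does $s(\psi(v))$. Subtracting it from $v$ changes nothing
after reduction and moves $v$ into $\ker\psi=\operatorname{im}\varphi$. -/
lemma range_mapLin_eq_ker [Fintype ι] [DecidableEq ι] [Fintype ι'] [DecidableEq ι'] [Fintype ι'']
    (hπ : Function.Surjective π)
    {φ : (ι → MvPolynomial (Fin (n + 1)) A) →ₗ[MvPolynomial (Fin (n + 1)) A]
      (ι' → MvPolynomial (Fin (n + 1)) A)}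
    {ψ : (ι' → MvPolynomial (Fin (n + 1)) A) →ₗ[MvPolynomial (Fin (n + 1)) A]
      (ι'' → MvPolynomial (Fin (n + 1)) A)} (hex : LinearMap.range φ = LinearMap.ker ψ)
    (s : (ι'' → MvPolynomial (Fin (n + 1)) A) →ₗ[A] (ι' → MvPolynomial (Fin (n + 1)) A))
    (hs : ∀ v, ψ (s (ψ v)) = ψ v) :
    LinearMap.range (mapLin π φ) = LinearMap.ker (mapLin π ψ) := by
  ext v
  constructor
  · rintro ⟨w, rfl⟩
    obtain ⟨w, rfl⟩ := mapVec_surjective hπ w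
    have : ψ (φ w) = 0 := by
      have : φ w ∈ LinearMap.range φ := ⟨w, rfl⟩
      rwa [hex] at this
    rw [LinearMap.mem_ker, mapLin_mapVec, mapLin_mapVec, this]
    ext1 b
    simp [mapVec]
  · intro hv
    obtain ⟨v, rfl⟩ := mapVec_surjective hπ v
    rw [LinearMap.mem_ker, mapLin_mapVec] at hv
    have h1 : v - s (ψ v) ∈ LinearMap.range φ := by
      rw [hex, LinearMap.mem_ker, map_sub, hs, sub_self]
    obtain ⟨w, hw⟩ := h1
    refine ⟨mapVec π w, ?_⟩
    rw [mapLin_mapVec, hw, mapVec_sub, mapVec_linearMap_eq_zero s hv, sub_zero]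

end BaseChange

/-! ### Splittings over the coefficient ring -/

section Splitting

variable {n : ℕ} {A : Type*} [CommRing A] {ι ι' : Type*} [Fintype ι']

/-- An $A$-linear projection onto the image lifts through $\varphi$, as its source is $A$-free. -/
lemma exists_splitting
    (φ : (ι → MvPolynomial (Fin (n + 1)) A) →ₗ[MvPolynomial (Fin (n + 1)) A]
      (ι' → MvPolynomial (Fin (n + 1)) A))
    (ρ : (ι' → MvPolynomial (Fin (n + 1)) A) →ₗ[A] (ι' → MvPolynomial (Fin (n + 1)) A))
    (hρ : ∀ x, ρ x ∈ LinearMap.range φ) (hρφ : ∀ v, ρ (φ v) = φ v) :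
    ∃ s : (ι' → MvPolynomial (Fin (n + 1)) A) →ₗ[A] (ι → MvPolynomial (Fin (n + 1)) A),
      ∀ v, φ (s (φ v)) = φ v := by
  have : Module.Projective A (ι' → MvPolynomial (Fin (n + 1)) A) := Module.Projective.of_free
  obtain ⟨s, hs⟩ := Module.projective_lifting_property (φ.restrictScalars A).rangeRestrict
    (ρ.codRestrict (LinearMap.range (φ.restrictScalars A)) hρ)
    (LinearMap.surjective_rangeRestrict _)
  refine ⟨s, fun v => ?_⟩
  have h1 := congrArg Subtype.val (DFunLike.congr_fun hs (φ v))
  exact h1.trans (hρφ v)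

end Splitting

/-! ### Reduction of minimal resolutions to a residue field -/

section Resolution

variable {n : ℕ} {A : Type*} [CommRing A] {I : Ideal (MvPolynomial (Fin (n + 1)) A)}

namespace MinimalResolution

variable (E : MinimalResolution I)

/-- The ranks of a resolution augmented by the polynomial ring. -/
def augRank : ℕ → ℕ
  | 0 => 1
  | q + 1 => E.rank q

/-- The degrees of a resolution augmented by the polynomial ring. -/
def augDeg : (q : ℕ) → Fin (E.augRank q) → ℤ
  | 0 => fun _ => 0
  | q + 1 => E.deg q

/-- The maps of a resolution augmented by the polynomial ring. -/
def augMap : (q : ℕ) → (Fin (E.augRank (q + 1)) → MvPolynomial (Fin (n + 1)) A)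
    →ₗ[MvPolynomial (Fin (n + 1)) A] (Fin (E.augRank q) → MvPolynomial (Fin (n + 1)) A)
  | 0 => LinearMap.pi fun _ => E.aug
  | q + 1 => E.d q

lemma range_augMap_succ (q : ℕ) :
    LinearMap.range (E.augMap (q + 1)) = LinearMap.ker (E.augMap q) := by
  cases q with
  | zero =>
    exact E.exact_zero.trans (Submodule.ext fun v =>
      ⟨fun h => funext fun _ => h, fun h => congrFun h (0 : Fin 1)⟩)
  | succ q => exact E.exact_succ q

lemma augMap_graded (q : ℕ) :
    ∀ a b, IsHomogeneousInt (E.augMap q (Pi.single a 1) b) (E.augDeg (q + 1) a - E.augDeg q b) := by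
  cases q with
  | zero =>
    intro a b
    have := E.aug_graded a
    rw [← sub_zero (E.deg 0 a)] at this
    exact this
  | succ q => exact E.d_graded q

/-- The complement gives a projection onto $I$. Inductively, a splitting $s$ of $\varphi_q$ gives
the projection $\mathrm{id}-s\varphi_q$ onto $\ker\varphi_q=\operatorname{im}\varphi_{q+1}$. -/
lemma exists_augMap_splitting {N : Submodule A (MvPolynomial (Fin (n + 1)) A)}
    (hN : IsCompl (I.restrictScalars A) N) (q : ℕ) :
    ∃ s : (Fin (E.augRank q) → MvPolynomial (Fin (n + 1)) A) →ₗ[A]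
      (Fin (E.augRank (q + 1)) → MvPolynomial (Fin (n + 1)) A),
      ∀ v, E.augMap q (s (E.augMap q v)) = E.augMap q v := by
  induction q with
  | zero =>
    refine exists_splitting (E.augMap 0) (LinearMap.pi fun _ =>
      ((I.restrictScalars A).subtype.comp (Submodule.projectionOnto _ _ hN)).comp
        (LinearMap.proj (0 : Fin 1))) (fun x => ?_) fun v => ?_
    · have h1 : (Submodule.projectionOnto _ _ hN (x (0 : Fin 1))).1 ∈ LinearMap.range E.aug := by
        rw [E.range_aug]
        exact (Submodule.projectionOnto _ _ hN (x (0 : Fin 1))).2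
      obtain ⟨v, hv⟩ := h1
      exact ⟨v, funext fun _ => hv⟩
    · funext b
      have h1 : E.aug v ∈ I.restrictScalars A := by
        have : E.aug v ∈ LinearMap.range E.aug := ⟨v, rfl⟩
        rwa [E.range_aug] at this
      exact congrArg Subtype.val (Submodule.projectionOnto_apply_left hN ⟨E.aug v, h1⟩)
  | succ q ih =>
    obtain ⟨s, hs⟩ := ih
    refine exists_splitting (E.augMap (q + 1))
      (LinearMap.id - s.comp ((E.augMap q).restrictScalars A)) (fun x => ?_) fun v => ?_
    · rw [E.range_augMap_succ, LinearMap.mem_ker]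
      change E.augMap q (x - s (E.augMap q x)) = 0
      rw [map_sub, hs, sub_self]
    · change E.augMap (q + 1) v - s (E.augMap q (E.augMap (q + 1) v)) = _
      have h1 : E.augMap (q + 1) v ∈ LinearMap.ker (E.augMap q) := by
        rw [← E.range_augMap_succ]
        exact ⟨v, rfl⟩
      rw [LinearMap.mem_ker.1 h1, map_zero, sub_zero]

variable {k : Type*} [Field k] {π : A →+* k}

/-- Base change of the augmented resolution to a residue field of the coefficients. -/
def baseChange {N : Submodule A (MvPolynomial (Fin (n + 1)) A)}
    (hN : IsCompl (I.restrictScalars A) N) (hπ : Function.Surjective π) : GradedExactSeq n k where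
  rk := E.augRank
  deg := E.augDeg
  φ q := mapLin π (E.augMap q)
  graded q a b := by
    rw [mapLin_single]
    exact (E.augMap_graded q a b).map
  exact q := by
    obtain ⟨s, hs⟩ := E.exists_augMap_splitting hN q
    exact range_mapLin_eq_ker hπ (E.range_augMap_succ q) s hs
  minimal q v b := by
    rw [mapLin_apply, map_sum]
    refine Finset.sum_eq_zero fun a _ => ?_
    have h1 : Ideal.jacobson (⊥ : Ideal A) ≤ RingHom.ker π := by
      have : (RingHom.ker π).IsMaximal := RingHom.ker_isMaximal_of_surjective π hπ
      exact sInf_le ⟨bot_le, this⟩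
    have h2 : π (constantCoeff (E.augMap (q + 1) (Pi.single a 1) b)) = 0 := h1 (E.minimal q a b)
    rw [map_mul, constantCoeff_map, h2, zero_mul]

lemma imagePart_baseChange {N : Submodule A (MvPolynomial (Fin (n + 1)) A)}
    (hN : IsCompl (I.restrictScalars A) N) (hπ : Function.Surjective π) (p : ℕ) (j : ℤ) :
    (E.baseChange hN hπ).imagePart 0 p j = idealPart (I.map (MvPolynomial.map π)) p j := by
  ext z
  refine Iff.trans ?_ mem_idealPart.symm
  constructor
  · rintro ⟨w, hw, rfl⟩
    refine ⟨((E.baseChange hN hπ).graded 0).compLeft_mem hw, fun σ => ?_⟩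
    change ∑ a : Fin (E.rank 0), MvPolynomial.map π (E.aug (Pi.single a 1)) * w σ a ∈ _
    refine Ideal.sum_mem _ fun a _ => Ideal.mul_mem_right _ _
      (Ideal.mem_map_of_mem (MvPolynomial.map π) ?_)
    have h1 : E.aug (Pi.single a 1) ∈ LinearMap.range E.aug := ⟨_, rfl⟩
    rwa [E.range_aug] at h1
  · rintro ⟨hz, hI⟩
    refine exists_compLeft_eq_of_mem ((E.baseChange hN hπ).graded 0) hz fun σ => ?_
    obtain ⟨i, hi, hiz⟩ := (Ideal.mem_map_iff_of_surjective _
      (MvPolynomial.map_surjective π hπ)).1 (hI σ)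
    rw [← E.range_aug] at hi
    obtain ⟨v, rfl⟩ := hi
    refine ⟨mapVec π v, (mapLin_mapVec (E.augMap 0) v).trans (funext fun b => ?_)⟩
    rw [show b = (0 : Fin 1) from Subsingleton.elim (α := Fin 1) _ _, ← hiz]
    rfl

/-- The Betti numbers of a minimal resolution of an ideal with free quotient are the dimensions of
the Koszul homology of the ideal after base change to a residue field. -/
theorem betti_eq_finrank {N : Submodule A (MvPolynomial (Fin (n + 1)) A)}
    (hN : IsCompl (I.restrictScalars A) N) (hπ : Function.Surjective π) (i : ℕ) (j : ℤ) :
    Module.Finite k (IdealHomology (I.map (MvPolynomial.map π)) i j) ∧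
      E.betti i j = Module.finrank k (IdealHomology (I.map (MvPolynomial.map π)) i j) := by
  have h1 := (E.baseChange hN hπ).finite_imageHomology i 0 j
  have h2 := (E.baseChange hN hπ).finrank_imageHomology i 0 j
  rw [zero_add] at h2
  -- The augmented sequence starts with $S$, so its place $i+1$ is $E_i$.
  have h3 : E.betti i j = Module.finrank k ((E.baseChange hN hπ).imageHomology 0 i j) := h2.symm
  have congr : ∀ Z₁ Z₀ : Submodule k (Finset (Fin (n + 1)) → Fin 1 → MvPolynomial (Fin (n + 1)) k),
      Z₁ = idealPart (I.map (MvPolynomial.map π)) (i + 1) j →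
      Z₀ = idealPart (I.map (MvPolynomial.map π)) i j →
      Module.Finite k (HomologyOf (koszulₗ n k (Fin 1)) Z₁ Z₀) →
      E.betti i j = Module.finrank k (HomologyOf (koszulₗ n k (Fin 1)) Z₁ Z₀) →
      Module.Finite k (IdealHomology (I.map (MvPolynomial.map π)) i j) ∧
        E.betti i j = Module.finrank k (IdealHomology (I.map (MvPolynomial.map π)) i j) := by
    rintro _ _ rfl rfl h4 h5
    exact ⟨h4, h5⟩
  exact congr _ _ (E.imagePart_baseChange hN hπ (i + 1) j) (E.imagePart_baseChange hN hπ i j) h1 h3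

end MinimalResolution

end Resolution

/-! ### Marked bases under reduction to a residue field -/

section MarkedBaseChange

variable {n : ℕ} {A : Type*} [CommRing A] {P : Finset (Fin (n + 1) →₀ ℕ)}
  {J : Ideal (MvPolynomial (Fin (n + 1)) A)} {k : Type*} [Field k] {π : A →+* k}

lemma IsPommaretBasis.map_eq_span (hP : IsPommaretBasis P J) :
    J.map (MvPolynomial.map π) =
      Ideal.span ((fun α => monomial α (1 : k)) '' (P : Set (Fin (n + 1) →₀ ℕ))) := by
  conv_lhs => rw [hP.span_eq]
  rw [Ideal.map_span, Set.image_image]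
  simp

lemma IsPommaretBasis.termsOf_map [Nontrivial A] (hP : IsPommaretBasis P J) :
    termsOf (J.map (MvPolynomial.map π)) = termsOf J := by
  ext γ
  rw [hP.mem_termsOf_iff, termsOf, Set.mem_ofPred_eq, hP.map_eq_span,
    mem_ideal_span_monomial_image]
  simp

lemma IsPommaretBasis.map [Nontrivial A] (hP : IsPommaretBasis P J) (π : A →+* k) :
    IsPommaretBasis P (J.map (MvPolynomial.map π)) where
  span_eq := hP.map_eq_span
  cones_eq := hP.termsOf_map.trans hP.cones_eq
  cones_disjoint := hP.cones_disjoint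

lemma map_mem_complementComponent {J' : Ideal (MvPolynomial (Fin (n + 1)) k)}
    (hJ : termsOf J' = termsOf J) {s : ℕ} {p : MvPolynomial (Fin (n + 1)) A}
    (hp : p ∈ complementComponent J s) : MvPolynomial.map π p ∈ complementComponent J' s := by
  rw [mem_complementComponent_iff] at *
  rw [hJ]
  exact fun γ hγ => hp γ (support_map_subset π p hγ)

lemma exists_map_eq_of_mem_complementComponent (hπ : Function.Surjective π)
    {J' : Ideal (MvPolynomial (Fin (n + 1)) k)}
    (hJ : termsOf J' = termsOf J) {s : ℕ} {p : MvPolynomial (Fin (n + 1)) k}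
    (hp : p ∈ complementComponent J' s) :
    ∃ q ∈ complementComponent J s, MvPolynomial.map π q = p := by
  obtain ⟨g, hg⟩ := hπ.hasRightInverse
  rw [mem_complementComponent_iff, hJ] at hp
  refine ⟨∑ γ ∈ p.support, monomial γ (g (coeff γ p)), Submodule.sum_mem _ fun γ hγ => ?_, ?_⟩
  · rw [mem_complementComponent_iff]
    intro η hη
    have := support_monomial_subset hη
    rw [Finset.mem_singleton] at this
    rw [this]
    exact hp γ hγ
  · rw [map_sum]
    simp only [map_monomial, hg _]
    exact (p.as_sum).symm

/-- For directness, lift a common element to $i\in I$ and to $q$ in the complement. As $i-q$ reduces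
to zero, so does its projection to $I$, which is $i$. -/
lemma IsMarkedBasis.map [Nontrivial A] (hπ : Function.Surjective π) (hP : IsPommaretBasis P J)
    {f : P → MvPolynomial (Fin (n + 1)) A} (hf : IsMarkedBasis P J f) :
    IsMarkedBasis P (J.map (MvPolynomial.map π)) fun α => MvPolynomial.map π (f α) := by
  have hJ : termsOf (J.map (MvPolynomial.map π)) = termsOf J := hP.termsOf_map
  have hI : Ideal.span (Set.range fun α => MvPolynomial.map π (f α)) =
      (Ideal.span (Set.range f)).map (MvPolynomial.map π) := by
    rw [Ideal.map_span, ← Set.range_comp]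
    rfl
  refine ⟨⟨fun α => (hf.isMarkedSet.homogeneous α).map π, fun α => ?_, fun α γ hγ => ?_⟩,
    fun s => ?_, fun s => ?_⟩
  · rw [coeff_map, hf.isMarkedSet.coeff_head, map_one]
  · rw [hJ]
    refine hf.isMarkedSet.tail α γ (support_map_subset π _ ?_)
    rwa [map_sub, map_monomial, map_one]
  · rw [Submodule.disjoint_def]
    intro x hx hx'
    have hxI : x ∈ Ideal.span (Set.range fun α => MvPolynomial.map π (f α)) := hx.1
    rw [hI, Ideal.mem_map_iff_of_surjective _ (MvPolynomial.map_surjective π hπ)] at hxI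
    obtain ⟨i, hi, rfl⟩ := hxI
    obtain ⟨q, hq, hqi⟩ := exists_map_eq_of_mem_complementComponent hπ hJ hx'
    have hqc : q ∈ complement J :=
      mem_complement_iff.2 fun γ hγ => (mem_complementComponent_iff.1 hq γ hγ).1
    let ρ := ((Ideal.span (Set.range f)).restrictScalars A).subtype.comp
      (Submodule.projectionOnto _ _ hf.isCompl)
    have h1 : mapVec π (fun _ : Fin 1 => i - q) = 0 := by
      ext1 a
      rw [mapVec, map_sub, hqi, sub_self, Pi.zero_apply]
    have h2 := mapVec_linearMap_eq_zero
      (LinearMap.pi fun _ : Fin 1 => ρ.comp (LinearMap.proj (0 : Fin 1))) h1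
    have h3 : ρ (i - q) = i := by
      rw [map_sub]
      have h4 : ρ i = i := congrArg Subtype.val
        (Submodule.projectionOnto_apply_left hf.isCompl ⟨i, hi⟩)
      have h5 : ρ q = 0 := congrArg Subtype.val
        (Submodule.projectionOnto_apply_right hf.isCompl ⟨q, hqc⟩)
      rw [h4, h5, sub_zero]
    have h6 : MvPolynomial.map π (ρ (i - q)) = 0 := congrFun h2 0
    rwa [h3] at h6
  · apply le_antisymm
    · refine sup_le inf_le_right fun p hp => ?_
      intro γ hγ
      rw [← (mem_complementComponent_iff.1 hp γ (mem_support_iff.2 hγ)).2]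
      exact (DFunLike.congr_fun Finsupp.degree_eq_weight_one γ).symm
    · intro p hp
      refine mem_of_forall_monomial_mem fun γ hγ => ?_
      have hdeg : γ.degree = s := by
        have : p.IsHomogeneous s := hp
        rw [← this (mem_support_iff.1 hγ)]
        exact DFunLike.congr_fun Finsupp.degree_eq_weight_one γ
      have h1 : monomial γ (1 : A) ∈ homogeneousSubmodule (Fin (n + 1)) A s :=
        isHomogeneous_monomial _ hdeg
      rw [← hf.sup_eq] at h1
      obtain ⟨i, hi, q, hq, hiq⟩ := Submodule.mem_sup.1 h1
      have h2 : monomial γ (1 : k) = MvPolynomial.map π i + MvPolynomial.map π q := by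
        rw [← map_add, hiq, map_monomial, map_one π]
      rw [h2]
      refine Submodule.add_mem_sup ⟨?_, ?_⟩ (map_mem_complementComponent hJ hq)
      · have h3 : MvPolynomial.map π i ∈
            Ideal.span (Set.range fun α => MvPolynomial.map π (f α)) := by
          rw [hI]
          exact Ideal.mem_map_of_mem _ hi.1
        exact h3
      · have h3 : i.IsHomogeneous s := hi.2
        exact h3.map π

end MarkedBaseChange

/-! ### Comparison of Betti numbers, regularity and projective dimension -/

section Main

variable {n : ℕ} {A : Type*} [CommRing A] [Nontrivial A] {P : Finset (Fin (n + 1) →₀ ℕ)}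
  {J : Ideal (MvPolynomial (Fin (n + 1)) A)}

/-- The Betti numbers of an ideal with a marked basis are bounded by the ranks of the resolution
attached to the Pommaret basis. -/
theorem betti_le_resRank (hP : IsPommaretBasis P J) {f : P → MvPolynomial (Fin (n + 1)) A}
    (hf : IsMarkedBasis P J f) (E : MinimalResolution (Ideal.span (Set.range f))) (i : ℕ) (j : ℤ) :
    E.betti i j ≤ resRank P i j := by
  obtain ⟨m, hm⟩ := Ideal.exists_maximal A
  let _ : Field (A ⧸ m) := Ideal.Quotient.field m
  have hπ := Ideal.Quotient.mk_surjective (I := m)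
  rw [(E.betti_eq_finrank hf.isCompl hπ i j).2]
  have h1 := finrank_idealHomology_le (hP.map (Ideal.Quotient.mk m)) (hf.map hπ hP) i j
  have h2 : Ideal.span (Set.range fun α => MvPolynomial.map (Ideal.Quotient.mk m) (f α)) =
      (Ideal.span (Set.range f)).map (MvPolynomial.map (Ideal.Quotient.mk m)) := by
    rw [Ideal.map_span, ← Set.range_comp]
    rfl
  rwa [h2] at h1

/-- Every element of the Pommaret basis of a quasi-stable ideal gives a nonzero Betti number. -/
theorem exists_betti_ne_zero (hJ : IsQuasiStable J) (hP : IsPommaretBasis P J)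
    (F : MinimalResolution J) {α : Fin (n + 1) →₀ ℕ} (hα : α ∈ P) :
    ∃ j : ℤ, (α.degree : ℤ) ≤ j - (n - minVar α : ℕ) ∧ F.betti (n - minVar α) j ≠ 0 := by
  obtain ⟨m, hm⟩ := Ideal.exists_maximal A
  let _ : Field (A ⧸ m) := Ideal.Quotient.field m
  have hπ := Ideal.Quotient.mk_surjective (I := m)
  have hqs := hJ.2
  rw [← hP.termsOf_map (π := Ideal.Quotient.mk m)] at hqs
  obtain ⟨j, hj, hns⟩ := (hP.map (Ideal.Quotient.mk m)).exists_not_subsingleton hqs hα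
  refine ⟨j, hj, fun h0 => hns ?_⟩
  obtain ⟨h1, h2⟩ := F.betti_eq_finrank hP.isCompl hπ (n - minVar α) j
  rw [h0] at h2
  exact Module.finrank_zero_iff.1 h2.symm

lemma exists_of_resRank_ne_zero {i : ℕ} {j : ℤ} (h : resRank P i j ≠ 0) :
    ∃ α ∈ P, (α.degree : ℤ) = j - i ∧ i ≤ n - minVar α := by
  obtain ⟨k, -, hk⟩ := Finset.exists_ne_zero_of_sum_ne_zero h
  rw [mul_ne_zero_iff, beta, Finset.card_ne_zero] at hk
  obtain ⟨h1, α, hα⟩ := hk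
  rw [Finset.mem_filter] at hα
  refine ⟨α, hα.1, hα.2.1, ?_⟩
  rw [hα.2.2]
  by_contra hlt
  exact h1 (Nat.choose_eq_zero_of_lt (not_le.1 hlt))

/-- A nonzero $b_{i,j}$ of $I$ produces $x^\alpha\in\mathcal P(J)$ of degree $j-i$, and this term a
nonzero Betti number of $J$ whose degree difference is at least $\deg x^\alpha$. -/
theorem reg_le_reg (hJ : IsQuasiStable J) (hP : IsPommaretBasis P J)
    {f : P → MvPolynomial (Fin (n + 1)) A} (hf : IsMarkedBasis P J f)
    (E : MinimalResolution (Ideal.span (Set.range f))) (F : MinimalResolution J) :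
    E.reg ≤ F.reg := by
  refine iSup_le fun i => iSup_le fun j => iSup_le fun hb => ?_
  obtain ⟨α, hα, hdeg, -⟩ := exists_of_resRank_ne_zero (P := P) (i := i) (j := j) fun h0 =>
    hb (Nat.le_zero.1 (h0 ▸ betti_le_resRank hP hf E i j))
  obtain ⟨j', hj', hb'⟩ := exists_betti_ne_zero hJ hP F hα
  refine le_trans ?_ (le_iSup_of_le (n - minVar α) (le_iSup_of_le j' (le_iSup_of_le hb' le_rfl)))
  rw [WithBot.coe_le_coe, WithTop.coe_le_coe, ← hdeg]
  exact hj'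

/-- The same term satisfies $i\le n-m$ for $x_m=\min(x^\alpha)$, and the resolution of $J$ is
nonzero in homological degree $n-m$. -/
theorem pdim_le_pdim (hJ : IsQuasiStable J) (hP : IsPommaretBasis P J)
    {f : P → MvPolynomial (Fin (n + 1)) A} (hf : IsMarkedBasis P J f)
    (E : MinimalResolution (Ideal.span (Set.range f))) (F : MinimalResolution J) :
    E.pdim ≤ F.pdim := by
  refine iSup_le fun i => iSup_le fun hr => ?_
  let a : Fin (E.rank i) := ⟨0, Nat.pos_of_ne_zero hr⟩
  have hb : E.betti i (E.deg i a) ≠ 0 := by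
    rw [MinimalResolution.betti, Finset.card_ne_zero]
    exact ⟨a, by simp⟩
  obtain ⟨α, hα, -, hi⟩ := exists_of_resRank_ne_zero (P := P) (i := i) (j := E.deg i a) fun h0 =>
    hb (Nat.le_zero.1 (h0 ▸ betti_le_resRank hP hf E i _))
  obtain ⟨j', -, hb'⟩ := exists_betti_ne_zero hJ hP F hα
  have hr' : F.rank (n - minVar α) ≠ 0 := by
    rw [MinimalResolution.betti, Finset.card_ne_zero] at hb'
    obtain ⟨b, -⟩ := hb'
    exact Nat.ne_zero_of_lt b.2
  refine le_trans ?_ (le_iSup_of_le (n - minVar α) (le_iSup_of_le hr' le_rfl))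
  rw [WithBot.coe_le_coe]
  exact_mod_cast hi

end Main

end MarkedBasis

end

theorem mainTheorem1 (K : Type*) [Field K] (A : Type*) [CommRing A] [Nontrivial A] [Algebra K A]
    [IsNoetherianRing A] (n : ℕ) (J : Ideal (MvPolynomial (Fin (n + 1)) A))
    (hJ : MarkedBasis.IsQuasiStable J)
    (P : Finset (Fin (n + 1) →₀ ℕ)) (hP : MarkedBasis.IsPommaretBasis P J)
    (f : P → MvPolynomial (Fin (n + 1)) A) (hf : MarkedBasis.IsMarkedBasis P J f)
    (I : Ideal (MvPolynomial (Fin (n + 1)) A)) (hI : I = Ideal.span (Set.range f)) :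
    (∀ (E : MarkedBasis.MinimalResolution I) (i : ℕ) (j : ℤ),
      E.betti i j ≤ MarkedBasis.resRank P i j) ∧
    (∀ (E : MarkedBasis.MinimalResolution I) (F : MarkedBasis.MinimalResolution J),
      E.reg ≤ F.reg) ∧
    (∀ (E : MarkedBasis.MinimalResolution I) (F : MarkedBasis.MinimalResolution J),
      E.pdim ≤ F.pdim) := by
  subst hI
  exact ⟨MarkedBasis.betti_le_resRank hP hf, MarkedBasis.reg_le_reg hJ hP hf,
    MarkedBasis.pdim_le_pdim hJ hP hf⟩
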